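/- **Corollary (evolution of preferred frames).** Let $U\subseteq\mathbb R^{n+m}$ be an open domain of local coordinates $u=(x^i,y^a)$ of an N-anholonomic manifold of dimension $n+m$ ($i,j,k$ are horizontal, $a,b,c,d$ vertical, $\alpha,\beta,\gamma$ arbitrary indices), and let $\tau_0>0$. For an N-connection $N_i^a$ put $\mathbf e_i=\partial_i-N_i^a\partial_a$, $e_a=\partial_a$ (the N-adapted frame $\mathbf e_\alpha$), with dual coframe $e^i=dx^i$, $\mathbf e^a=dy^a+N^a_idx^i$. For a nondegenerate d-metric $\mathbf g=g_{ij}e^i\otimes e^j+g_{ab}\mathbf e^a\otimes\mathbf e^b$ let $\widehat{\mathbf D}$ be its canonical d-connection, whose N-adapted coefficients are $$L^i_{jk}=\tfrac12g^{ir}(\mathbf e_kg_{jr}+\mathbf e_jg_{kr}-\mathbf e_rg_{jk}),\qquad L^a_{bk}=\partial_bN^a_k+\tfrac12g^{ac}(\mathbf e_kg_{bc}-g_{dc}\partial_bN^d_k-g_{db}\partial_cN^d_k),$$ $$C^i_{jc}=\tfrac12g^{ik}\partial_cg_{jk},\qquad C^a_{bc}=\tfrac12g^{ad}(\partial_cg_{bd}+\partial_bg_{cd}-\partial_dg_{bc}),$$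 and let $\widehat{\mathbf R}_{\beta\gamma}=[\widehat R_{ij},\widehat R_{ia},\widehat R_{ai},\widehat R_{ab}]$ be its Ricci d-tensor, $\widehat{\mathbf R}_{\beta\gamma}=\widehat{\mathbf R}^{\alpha}{}_{\beta\gamma\alpha}$, in the N-adapted frame. Let $(g_{ij},g_{ab},N_i^a)(\tau,u)$ be a smooth family of such data on $[0,\tau_0)\times U$ that is an N-anholonomic Ricci flow: $\partial_\tau g_{ij}=-2\widehat R_{ij}$ and $\partial_\tau g_{ab}=-2\widehat R_{ab}$ (derivatives at $\tau=0$ are one-sided). Fix $\eta_{\underline i\underline j}=\mathrm{diag}[\pm1,\dots,\pm1]$ and $\eta_{\underline a\underline b}=\mathrm{diag}[\pm1,\dots,\pm1]$. A *preferred frame* at $(\tau,u)$ is a frame $E_{\underline\alpha}$ of tangent vectors whose matrix of coordinate components and the inverse of that matrix are $$\begin{bmatrix}e^i{}_{\underline i}&-e^k{}_{\underline i}N_k^b\\0&e^a{}_{\underline a}\end{bmatrix},\qquad \begin{bmatrix}e_i{}^{\underline i}&N_i^be_b{}^{\underline a}\\0&e_a{}^{\underline a}\end{bmatrix},$$ where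 $(e^i{}_{\underline i})$, $(e^a{}_{\underline a})$ are inverse to the invertible blocks $(e_i{}^{\underline i})$, $(e_a{}^{\underline a})$, and $g_{ij}=e_i{}^{\underline i}e_j{}^{\underline j}\eta_{\underline i\underline j}$, $g_{ab}=e_a{}^{\underline a}e_b{}^{\underline b}\eta_{\underline a\underline b}$. Let $\mathbf e^\alpha{}_{\underline\alpha}(\tau,u)$ denote the N-adapted components of a family of frames, $E_{\underline\alpha}=\mathbf e^\alpha{}_{\underline\alpha}\mathbf e_\alpha(\tau)$, and consider the equation $$\frac{\partial}{\partial\tau}\mathbf e^\alpha{}_{\underline\alpha}=\mathbf g^{\alpha\beta}\,\widehat{\mathbf R}_{\beta\gamma}\,\mathbf e^\gamma{}_{\underline\alpha}\qquad\text{on }[0,\tau_0)\times U,\tag{$*$}$$ where only the symmetric h- and v-parts $\tfrac12(\widehat R_{ij}+\widehat R_{ji})$ and $\tfrac12(\widehat R_{ab}+\widehat R_{ba})$ of the canonical Ricci d-tensor are used in $\widehat{\mathbf R}_{\beta\gamma}$. Then: 1. Every smooth field of preferred frames on $U$ at $\tau=0$ extends to a smooth family of frames on all of $[0,\tau_0)\times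 U$ that satisfies $(*)$, and this solution of $(*)$ is unique. It consists of preferred frames of $(g_{ij},g_{ab},N_i^a)(\tau,u)$ for every $\tau\in[0,\tau_0)$ and $u\in U$. 2. For every smooth family $E$ of preferred frames on $[0,\tau_0)\times U$ there are unique matrices $\Lambda=\mathrm{diag}(\Lambda_h,\Lambda_v)(\tau,u)$ that are the identity at $\tau=0$ and for which the rotated family $\Lambda E$ satisfies $(*)$; they are smooth and $\eta$-orthogonal, $\Lambda_h\eta\Lambda_h^{T}=\eta$ and $\Lambda_v\eta\Lambda_v^{T}=\eta$. 3. Along the flow, $\widehat R_{ij}=\widehat R_{ji}$ and $\widehat R_{ab}=\widehat R_{ba}$. A family of preferred frames that satisfies $(*)$ also satisfies the equation with all components of $\widehat{\mathbf R}_{\beta\gamma}$ if and only if $\widehat R_{ia}=\widehat R_{ai}=0$ on $[0,\tau_0)\times U$. 4. A family of preferred frames that satisfies $(*)$ also satisfies $(*)$ with all objects replaced by their components in the coordinate basis $\partial_\alpha$ if and only if $N_i^a$ does not depend on $\tau$. -/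

import Mathlib

open scoped ContDiff Matrix

noncomputable section

namespace NAnholonomic

/-- Index set of an `n + m` splitting: `Sum.inl i` are the horizontal indices `i, j, k, …`,
`Sum.inr a` are the vertical indices `a, b, c, …`. -/
abbrev Idx (n m : ℕ) : Type := Fin n ⊕ Fin m

/-- Local coordinates `u = (x, y)`, `x ∈ ℝⁿ`, `y ∈ ℝᵐ`. -/
abbrev Coord (n m : ℕ) : Type := Idx n m → ℝ

variable {n m : ℕ}

/-- Coordinate partial derivative `∂_α f`. -/
def pd (α : Idx n m) (f : Coord n m → ℝ) (u : Coord n m) : ℝ :=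
  fderiv ℝ f u (Pi.single α 1)

/-- The N-adapted frame `e_i = ∂_i - N_i^a ∂_a`, `e_a = ∂_a` acting on functions.
The coefficient `N_i^a` of the N-connection is the matrix entry `N u a i`. -/
def eDer (N : Coord n m → Matrix (Fin m) (Fin n) ℝ) (α : Idx n m)
    (f : Coord n m → ℝ) (u : Coord n m) : ℝ :=
  match α with
  | Sum.inl i => pd (Sum.inl i) f u - ∑ a, N u a i * pd (Sum.inr a) f u
  | Sum.inr a => pd (Sum.inr a) f u

/-- Anholonomy coefficients `W^γ_{αβ}` of the N-adapted frame, `[e_α, e_β] = W^γ_{αβ} e_γ`: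
`W^a_{ij} = e_j N_i^a - e_i N_j^a` (the curvature of the N-connection),
`W^b_{ia} = - W^b_{ai} = ∂_a N_i^b`, all others zero. -/
def anholonomy (N : Coord n m → Matrix (Fin m) (Fin n) ℝ) (γ α β : Idx n m)
    (u : Coord n m) : ℝ :=
  match γ, α, β with
  | Sum.inr a, Sum.inl i, Sum.inl j =>
      eDer N (Sum.inl j) (fun w => N w a i) u - eDer N (Sum.inl i) (fun w => N w a j) u
  | Sum.inr b, Sum.inl i, Sum.inr a => pd (Sum.inr a) (fun w => N w b i) u
  | Sum.inr b, Sum.inr a, Sum.inl i => - pd (Sum.inr a) (fun w => N w b i) u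
  | _, _, _ => 0

/-- N-adapted coefficients `Γ^γ_{αβ}` (`D_{e_β} e_α = Γ^γ_{αβ} e_γ`) of the canonical
d-connection of the d-metric `g_{ij} e^i ⊗ e^j + g_{ab} e^a ⊗ e^b`. The four families are
`L^i_{jk}`, `L^a_{bk}`, `C^i_{jc}`, `C^a_{bc}`. -/
def canonicalConn (gh : Coord n m → Matrix (Fin n) (Fin n) ℝ)
    (gv : Coord n m → Matrix (Fin m) (Fin m) ℝ)
    (N : Coord n m → Matrix (Fin m) (Fin n) ℝ) (γ α β : Idx n m) (u : Coord n m) : ℝ :=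
  match γ, α, β with
  | Sum.inl i, Sum.inl j, Sum.inl k =>
      (1 / 2) * ∑ r, (gh u)⁻¹ i r *
        (eDer N (Sum.inl k) (fun w => gh w j r) u + eDer N (Sum.inl j) (fun w => gh w k r) u
          - eDer N (Sum.inl r) (fun w => gh w j k) u)
  | Sum.inr a, Sum.inr b, Sum.inl k =>
      pd (Sum.inr b) (fun w => N w a k) u +
      (1 / 2) * ∑ c, (gv u)⁻¹ a c *
        (eDer N (Sum.inl k) (fun w => gv w b c) u
          - ∑ d, gv u d c * pd (Sum.inr b) (fun w => N w d k) u
          - ∑ d, gv u d b * pd (Sum.inr c) (fun w => N w d k) u)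
  | Sum.inl i, Sum.inl j, Sum.inr c =>
      (1 / 2) * ∑ k, (gh u)⁻¹ i k * pd (Sum.inr c) (fun w => gh w j k) u
  | Sum.inr a, Sum.inr b, Sum.inr c =>
      (1 / 2) * ∑ d, (gv u)⁻¹ a d *
        (pd (Sum.inr c) (fun w => gv w b d) u + pd (Sum.inr b) (fun w => gv w c d) u
          - pd (Sum.inr d) (fun w => gv w b c) u)
  | _, _, _ => 0

/-- Curvature of the canonical d-connection in the N-adapted frame:
`R(e_δ, e_γ) e_β = R^α_{βγδ} e_α`, where `R(X, Y) = D_X D_Y - D_Y D_X - D_{[X,Y]}`. -/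
def curvature (gh : Coord n m → Matrix (Fin n) (Fin n) ℝ)
    (gv : Coord n m → Matrix (Fin m) (Fin m) ℝ)
    (N : Coord n m → Matrix (Fin m) (Fin n) ℝ) (α β γ δ : Idx n m) (u : Coord n m) : ℝ :=
  eDer N δ (canonicalConn gh gv N α β γ) u - eDer N γ (canonicalConn gh gv N α β δ) u
    + ∑ φ, (canonicalConn gh gv N φ β γ u * canonicalConn gh gv N α φ δ u
          - canonicalConn gh gv N φ β δ u * canonicalConn gh gv N α φ γ u
          + canonicalConn gh gv N α β φ u * anholonomy N φ γ δ u)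

/-- The canonical Ricci d-tensor `R̂_{βγ} = R^α_{βγα}`, with N-adapted components. It need not be
symmetric, and its mixed components `R̂_{ia}`, `R̂_{ai}` need not vanish. -/
def ricci (gh : Coord n m → Matrix (Fin n) (Fin n) ℝ)
    (gv : Coord n m → Matrix (Fin m) (Fin m) ℝ)
    (N : Coord n m → Matrix (Fin m) (Fin n) ℝ) (u : Coord n m) :
    Matrix (Idx n m) (Idx n m) ℝ :=
  Matrix.of fun β γ => ∑ α, curvature gh gv N α β γ α u

/-- The symmetric h- and v-parts of a matrix of N-adapted components `R_{βγ}`. -/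
def symHV (R : Matrix (Idx n m) (Idx n m) ℝ) : Matrix (Idx n m) (Idx n m) ℝ :=
  Matrix.fromBlocks ((1 / 2 : ℝ) • (R.toBlocks₁₁ + R.toBlocks₁₁ᵀ)) 0
    0 ((1 / 2 : ℝ) • (R.toBlocks₂₂ + R.toBlocks₂₂ᵀ))

/-- N-adapted components `g_{αβ} = [g_{ij}, g_{ab}]` of a d-metric. -/
def dMetric (gh : Matrix (Fin n) (Fin n) ℝ) (gv : Matrix (Fin m) (Fin m) ℝ) :
    Matrix (Idx n m) (Idx n m) ℝ :=
  Matrix.fromBlocks gh 0 0 gv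

/-- The matrix `C` with `∂_α = C_α^β e_β`, i.e. `∂_i = e_i + N_i^a e_a`, `∂_a = e_a`. -/
def toAdapted (N : Matrix (Fin m) (Fin n) ℝ) : Matrix (Idx n m) (Idx n m) ℝ :=
  Matrix.fromBlocks 1 Nᵀ 0 1

/-- Coordinate components of the covariant 2-tensor with N-adapted components `T`. -/
def coordTensor (N : Matrix (Fin m) (Fin n) ℝ) (T : Matrix (Idx n m) (Idx n m) ℝ) :
    Matrix (Idx n m) (Idx n m) ℝ :=
  toAdapted N * T * (toAdapted N)ᵀ

/-- The block form `e_α^α̲ = [[e_i^i̲, N_i^b e_b^a̲], [0, e_a^a̲]]` (row `α`, column `α̲`) built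
from `A = (e_i^i̲)` and `B = (e_a^a̲)`. -/
def coframeMatrix (N : Matrix (Fin m) (Fin n) ℝ) (A : Matrix (Fin n) (Fin n) ℝ)
    (B : Matrix (Fin m) (Fin m) ℝ) : Matrix (Idx n m) (Idx n m) ℝ :=
  Matrix.fromBlocks A (Nᵀ * B) 0 B

/-- The block form `e^α_α̲ = [[e^i_i̲, -e^k_i̲ N_k^b], [0, e^a_a̲]]` (row `α̲`, column `α`) built
from `P = (e^i_i̲)` and `Q = (e^a_a̲)`. -/
def frameMatrix (N : Matrix (Fin m) (Fin n) ℝ) (P : Matrix (Fin n) (Fin n) ℝ)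
    (Q : Matrix (Fin m) (Fin m) ℝ) : Matrix (Idx n m) (Idx n m) ℝ :=
  Matrix.fromBlocks P (-(P * Nᵀ)) 0 Q

/-- `E` is (at one point and one time) the matrix of coordinate components of a preferred
N-adapted frame `E_α̲ = E_α̲^α ∂_α` (row `α̲`, column `α`): it and its inverse have the block
forms above, and `g_{ij} = e_i^i̲ e_j^j̲ η_{i̲j̲}`, `g_{ab} = e_a^a̲ e_b^b̲ η_{a̲b̲}`. -/
def IsPreferredFrame (ηh : Fin n → ℝ) (ηv : Fin m → ℝ) (gh : Matrix (Fin n) (Fin n) ℝ)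
    (gv : Matrix (Fin m) (Fin m) ℝ) (N : Matrix (Fin m) (Fin n) ℝ)
    (E : Matrix (Idx n m) (Idx n m) ℝ) : Prop :=
  ∃ (A : Matrix (Fin n) (Fin n) ℝ) (B : Matrix (Fin m) (Fin m) ℝ),
    IsUnit A.det ∧ IsUnit B.det ∧
    E = frameMatrix N A⁻¹ B⁻¹ ∧ coframeMatrix N A B * E = 1 ∧
    gh = A * Matrix.diagonal ηh * Aᵀ ∧ gv = B * Matrix.diagonal ηv * Bᵀ

/-- N-adapted components of the frame with coordinate components `E`: `E_α̲ = e^α_α̲ e_α(τ)`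
(row `α̲`, column `α`). -/
def adaptedComponents (N : ℝ → Coord n m → Matrix (Fin m) (Fin n) ℝ)
    (E : ℝ → Coord n m → Matrix (Idx n m) (Idx n m) ℝ) :
    ℝ → Coord n m → Matrix (Idx n m) (Idx n m) ℝ :=
  fun τ u => E τ u * toAdapted (N τ u)

/-- The family of matrices `M(τ, u)` is smooth on `[0, τ₀) × U`. -/
def SmoothFamily {ι κ : Type} (U : Set (Coord n m)) (τ₀ : ℝ)
    (M : ℝ → Coord n m → Matrix ι κ ℝ) : Prop :=
  ∀ i j, ContDiffOn ℝ ∞ (fun p : ℝ × Coord n m => M p.1 p.2 i j) (Set.Ico 0 τ₀ ×ˢ U)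

/-- The evolution equation `∂e^α_α̲/∂τ = g^{αβ} R_{βγ} e^γ_α̲` on `[0, τ₀) × U`
(`e τ u α̲ α` stands for `e^α_α̲`; the derivative at `τ = 0` is one-sided). -/
def FrameEvolution (U : Set (Coord n m)) (τ₀ : ℝ)
    (g R e : ℝ → Coord n m → Matrix (Idx n m) (Idx n m) ℝ) : Prop :=
  ∀ τ ∈ Set.Ico 0 τ₀, ∀ u ∈ U, ∀ α α' : Idx n m,
    HasDerivWithinAt (fun s => e s u α' α)
      (∑ β, ∑ γ, (g τ u)⁻¹ α β * R τ u β γ * e τ u α' γ) (Set.Ico 0 τ₀) τ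

/-- An N-anholonomic Ricci flow on the coordinate domain `U` for `τ ∈ [0, τ₀)`: a smooth family of
nondegenerate d-metrics and N-connections with `∂g_{ij}/∂τ = -2 R̂_{ij}`,
`∂g_{ab}/∂τ = -2 R̂_{ab}` in the N-adapted frames. -/
structure IsRicciFlow (U : Set (Coord n m)) (τ₀ : ℝ)
    (gh : ℝ → Coord n m → Matrix (Fin n) (Fin n) ℝ)
    (gv : ℝ → Coord n m → Matrix (Fin m) (Fin m) ℝ)
    (N : ℝ → Coord n m → Matrix (Fin m) (Fin n) ℝ) : Prop where
  smooth_h : SmoothFamily U τ₀ gh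
  smooth_v : SmoothFamily U τ₀ gv
  smooth_N : SmoothFamily U τ₀ N
  symm_h : ∀ τ ∈ Set.Ico 0 τ₀, ∀ u ∈ U, (gh τ u).IsSymm
  symm_v : ∀ τ ∈ Set.Ico 0 τ₀, ∀ u ∈ U, (gv τ u).IsSymm
  nondeg_h : ∀ τ ∈ Set.Ico 0 τ₀, ∀ u ∈ U, (gh τ u).det ≠ 0
  nondeg_v : ∀ τ ∈ Set.Ico 0 τ₀, ∀ u ∈ U, (gv τ u).det ≠ 0
  evol_h : ∀ τ ∈ Set.Ico 0 τ₀, ∀ u ∈ U, ∀ i j : Fin n,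
    HasDerivWithinAt (fun s => gh s u i j)
      (-2 * ricci (gh τ) (gv τ) (N τ) u (Sum.inl i) (Sum.inl j)) (Set.Ico 0 τ₀) τ
  evol_v : ∀ τ ∈ Set.Ico 0 τ₀, ∀ u ∈ U, ∀ a b : Fin m,
    HasDerivWithinAt (fun s => gv s u a b)
      (-2 * ricci (gh τ) (gv τ) (N τ) u (Sum.inr a) (Sum.inr b)) (Set.Ico 0 τ₀) τ

/-- Matrices of frame coefficients depending on `τ` and `u`. -/
abbrev FrameFamily (n m : ℕ) : Type := ℝ → Coord n m → Matrix (Idx n m) (Idx n m) ℝ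

/-- For all `τ ∈ [0, τ₀)` and `u ∈ U`, `E τ u` is a preferred frame of the metric and N-connection
at time `τ`. -/
def PreferredFamily (U : Set (Coord n m)) (τ₀ : ℝ) (ηh : Fin n → ℝ) (ηv : Fin m → ℝ)
    (gh : ℝ → Coord n m → Matrix (Fin n) (Fin n) ℝ)
    (gv : ℝ → Coord n m → Matrix (Fin m) (Fin m) ℝ)
    (N : ℝ → Coord n m → Matrix (Fin m) (Fin n) ℝ) (E : FrameFamily n m) : Prop :=
  ∀ τ ∈ Set.Ico 0 τ₀, ∀ u ∈ U, IsPreferredFrame ηh ηv (gh τ u) (gv τ u) (N τ u) (E τ u)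

/-- `∂e^α_α̲/∂τ = g^{αβ} R̂_{βγ} e^γ_α̲` for the N-adapted components of the frames `E`, where only
the symmetric h- and v-parts of the canonical Ricci d-tensor are used. -/
def Evolves (U : Set (Coord n m)) (τ₀ : ℝ)
    (gh : ℝ → Coord n m → Matrix (Fin n) (Fin n) ℝ)
    (gv : ℝ → Coord n m → Matrix (Fin m) (Fin m) ℝ)
    (N : ℝ → Coord n m → Matrix (Fin m) (Fin n) ℝ) (E : FrameFamily n m) : Prop :=
  FrameEvolution U τ₀ (fun τ u => dMetric (gh τ u) (gv τ u))
    (fun τ u => symHV (ricci (gh τ) (gv τ) (N τ) u)) (adaptedComponents N E)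

/-- The same equation with all components `R̂_{ij}, R̂_{ia}, R̂_{ai}, R̂_{ab}`. -/
def EvolvesFull (U : Set (Coord n m)) (τ₀ : ℝ)
    (gh : ℝ → Coord n m → Matrix (Fin n) (Fin n) ℝ)
    (gv : ℝ → Coord n m → Matrix (Fin m) (Fin m) ℝ)
    (N : ℝ → Coord n m → Matrix (Fin m) (Fin n) ℝ) (E : FrameFamily n m) : Prop :=
  FrameEvolution U τ₀ (fun τ u => dMetric (gh τ u) (gv τ u))
    (fun τ u => ricci (gh τ) (gv τ) (N τ) u) (adaptedComponents N E)

/-- The equation of `Evolves` with every object replaced by its components with respect to the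
coordinate basis `∂_α`. -/
def EvolvesCoord (U : Set (Coord n m)) (τ₀ : ℝ)
    (gh : ℝ → Coord n m → Matrix (Fin n) (Fin n) ℝ)
    (gv : ℝ → Coord n m → Matrix (Fin m) (Fin m) ℝ)
    (N : ℝ → Coord n m → Matrix (Fin m) (Fin n) ℝ) (E : FrameFamily n m) : Prop :=
  FrameEvolution U τ₀ (fun τ u => coordTensor (N τ u) (dMetric (gh τ u) (gv τ u)))
    (fun τ u => coordTensor (N τ u) (symHV (ricci (gh τ) (gv τ) (N τ) u))) E

end NAnholonomic

end

open NAnholonomic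

open Set Filter Topology intervalIntegral

/-! At each point `u` the evolution equation is a linear ODE in `τ`. In N-adapted components it
reads `e' = e (g⁻¹R)ᵀ` with `g` and `R` block diagonal, so the h- and v-blocks decouple, and the
N-connection enters only through the algebraic passage from adapted to coordinate components.

Linearity gives existence on all of `[0, τ₀)` and uniqueness. If `∂g = -2R` with `g`, `R` symmetric,
then `P g Pᵀ` has derivative `PRPᵀ - 2PRPᵀ + PRPᵀ = 0` along a solution `P`, so orthonormality
persists (`exists_orthonormal_evolution`). The formula for the Ricci tensor is never expanded: since
it is `-1/2` times the derivative of the metric, it inherits symmetry and smoothness from the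
metric.

The rotation carrying a preferred family `E` to a solution is `F E⁻¹`, where `F` is the solution
with the initial value of `E`. The two equivalences compare equations with a common solution: using
the full Ricci tensor changes the right side by its mixed blocks times invertible matrices, and
passing to coordinate components adds the term `E C'`, where `C` is the change of basis built from
`N`.

The analytic input is joint smoothness in `(τ, u)` up to the boundary `τ = 0`
(`exists_contDiffOn_linear_ODE`). Rescaling time, `y(σ) = x(στ, u)` solves `(1 - V) y = x₀(u)` in
the Banach space of curves on `[0, 1]`, where `V` is the Volterra operator with kernel `τ A(στ, u)`.
The kernel depends smoothly on `(τ, u)` (`contDiffOn_pullbackCurve`), `1 - V` is always invertible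
(`isUnit_one_sub_volterra`), and inversion is smooth in a Banach algebra. -/

/-- The pullback `p ↦ (σ ↦ B (L_σ p))`, as a map into continuous functions (zero where it is not
continuous in `σ`). -/
noncomputable def pullbackCurve {P E : Type*} [NormedAddCommGroup P] [NormedSpace ℝ P]
    [NormedAddCommGroup E] {I : Type*} [TopologicalSpace I]
    (L : C(I, P →L[ℝ] P)) (B : P → E) (p : P) : C(I, E) :=
  open Classical in
  if h : Continuous fun σ => B (L σ p) then ⟨_, h⟩ else 0

/-! ### Smoothness of pullbacks with values in spaces of continuous functions. -/

section Pullback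

universe v
variable {P : Type v} [NormedAddCommGroup P] [NormedSpace ℝ P]
  {I : Type*} [TopologicalSpace I] {S : Set P} {L : C(I, P →L[ℝ] P)}

lemma pullbackCurve_apply {E : Type*} [NormedAddCommGroup E] {B : P → E}
    (hB : ContinuousOn B S) (hL : ∀ σ, MapsTo (L σ) S S) {p : P} (hp : p ∈ S) (σ : I) :
    pullbackCurve L B p σ = B (L σ p) := by
  have h : Continuous fun σ => B (L σ p) :=
    hB.comp_continuous (by fun_prop) fun σ => hL σ hp
  simp [pullbackCurve, h]

lemma continuousOn_pullbackCurve {E : Type*} [NormedAddCommGroup E] {B : P → E}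
    (hB : ContinuousOn B S) (hL : ∀ σ, MapsTo (L σ) S S) :
    ContinuousOn (pullbackCurve L B) S := by
  rw [continuousOn_iff_continuous_domRestrict]
  apply ContinuousMap.continuous_of_continuous_uncurry
  have : (Function.uncurry fun (x : S) (y : I) => (S.domRestrict (pullbackCurve L B) x) y)
      = fun q : S × I => B (L q.2 q.1) := by
    ext ⟨x, y⟩
    exact pullbackCurve_apply hB hL x.2 y
  rw [this]
  refine hB.comp_continuous ?_ fun q => hL _ q.1.2
  fun_prop

variable [CompactSpace I]

/-- The linear map `f ↦ (v ↦ (σ ↦ f_σ (L_σ v)))`. -/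
noncomputable def precompCurve {E : Type*} [NormedAddCommGroup E] [NormedSpace ℝ E]
    (L : C(I, P →L[ℝ] P)) : C(I, P →L[ℝ] E) →L[ℝ] P →L[ℝ] C(I, E) :=
  LinearMap.mkContinuous₂
    (LinearMap.mk₂ ℝ (fun (f : C(I, P →L[ℝ] E)) (v : P) =>
        (⟨fun σ => f σ (L σ v), by fun_prop⟩ : C(I, E)))
      (fun _ _ _ => by ext; simp) (fun _ _ _ => by ext; simp)
      (fun _ _ _ => by ext; simp) (fun _ _ _ => by ext; simp)) ‖L‖
    (fun f v => by
      rw [ContinuousMap.norm_le _ (by positivity)]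
      intro σ
      calc ‖f σ (L σ v)‖ ≤ ‖f σ‖ * (‖L σ‖ * ‖v‖) :=
            (f σ).le_opNorm_of_le ((L σ).le_opNorm v)
        _ ≤ ‖f‖ * (‖L‖ * ‖v‖) := by
            gcongr
            exacts [f.norm_coe_le_norm σ, L.norm_coe_le_norm σ]
        _ = ‖L‖ * ‖f‖ * ‖v‖ := by ring)

lemma precompCurve_apply {E : Type*} [NormedAddCommGroup E] [NormedSpace ℝ E]
    (f : C(I, P →L[ℝ] E)) (v : P) (σ : I) : precompCurve L f v σ = f σ (L σ v) := rfl

/-- The mean value inequality is applied to `q ↦ B (L_σ q)` for each `σ`. Continuity of the pullback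
of `B'` in the sup norm makes the error constant `c` uniform in `σ`; convexity of small pieces of
`S` replaces convexity of `S`. -/
lemma hasFDerivWithinAt_pullbackCurve {E : Type*} [NormedAddCommGroup E] [NormedSpace ℝ E]
    (hS : ∀ p ∈ S, ∀ᶠ r in 𝓝[>] (0 : ℝ), Convex ℝ (S ∩ Metric.ball p r))
    (hL : ∀ σ, MapsTo (L σ) S S) {B : P → E} {B' : P → P →L[ℝ] E}
    (hB : ∀ p ∈ S, HasFDerivWithinAt B (B' p) S p) (hB' : ContinuousOn B' S) {p : P}
    (hp : p ∈ S) :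
    HasFDerivWithinAt (pullbackCurve L B) (precompCurve L (pullbackCurve L B' p)) S p := by
  have hBc : ContinuousOn B S := fun q hq => (hB q hq).continuousWithinAt
  rw [hasFDerivWithinAt_iff_isLittleO, Asymptotics.isLittleO_iff]
  intro c hc
  have hD : ContinuousWithinAt (fun q => precompCurve L (pullbackCurve L B' q)) S p :=
    (precompCurve L).continuous.continuousAt.comp_continuousWithinAt
      (continuousOn_pullbackCurve hB' hL p hp)
  obtain ⟨δ, hδ, hδc⟩ := Metric.continuousWithinAt_iff.1 hD c hc
  obtain ⟨r, hr, hr0, hrδ⟩ := ((hS p hp).and (Ioo_mem_nhdsGT hδ)).exists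
  have hmem : S ∩ Metric.ball p r ∈ 𝓝[S] p :=
    inter_mem_nhdsWithin S (Metric.ball_mem_nhds p hr0)
  filter_upwards [hmem] with q hq
  rw [ContinuousMap.norm_le _ (by positivity)]
  intro σ
  have key := hr.norm_image_sub_le_of_norm_hasFDerivWithin_le' (f := fun q => B (L σ q))
    (f' := fun q => (B' (L σ q)).comp (L σ)) (φ := (B' (L σ p)).comp (L σ)) (C := c)
    (x := p) (y := q) ?_ ?_ ⟨hp, Metric.mem_ball_self hr0⟩ hq
  · simpa [pullbackCurve_apply hBc hL hp, pullbackCurve_apply hBc hL hq.1,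
      pullbackCurve_apply hB' hL hp, precompCurve_apply] using key
  · intro z hz
    exact ((hB _ (hL σ hz.1)).comp z (L σ).hasFDerivWithinAt (hL σ)).mono inter_subset_left
  · intro z hz
    have h1 : ‖precompCurve L (pullbackCurve L B' z) - precompCurve L (pullbackCurve L B' p)‖
        ≤ c := by
      rw [← dist_eq_norm]
      exact (hδc hz.1 (lt_trans hz.2 hrδ)).le
    refine ContinuousLinearMap.opNorm_le_bound _ hc.le fun v => ?_
    have h2 := ((precompCurve L (pullbackCurve L B' z)
      - precompCurve L (pullbackCurve L B' p)) v).norm_coe_le_norm σ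
    have h3 := ContinuousLinearMap.le_of_opNorm_le _ h1 v
    refine le_trans ?_ (h2.trans h3)
    simp [pullbackCurve_apply hB' hL hp, pullbackCurve_apply hB' hL hz.1, precompCurve_apply]

/-- The derivative is the pullback of `B'` followed by a fixed continuous linear map, so induction
on the order works. The target changes from `E` to `P →L[ℝ] E` at each step, hence the quantifier
over `E` inside and the shared universe. -/
lemma contDiffOn_pullbackCurve_nat (hSu : UniqueDiffOn ℝ S)
    (hS : ∀ p ∈ S, ∀ᶠ r in 𝓝[>] (0 : ℝ), Convex ℝ (S ∩ Metric.ball p r))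
    (hL : ∀ σ, MapsTo (L σ) S S) (k : ℕ) :
    ∀ {E : Type v} [NormedAddCommGroup E] [NormedSpace ℝ E] {B : P → E},
      ContDiffOn ℝ k B S → ContDiffOn ℝ k (pullbackCurve L B) S := by
  induction k with
  | zero =>
    intro E _ _ B hB
    simp only [Nat.cast_zero, contDiffOn_zero] at hB ⊢
    exact continuousOn_pullbackCurve hB hL
  | succ k ih =>
    intro E _ _ B hB
    push_cast at hB ⊢
    rw [contDiffOn_succ_iff_hasFDerivWithinAt_of_uniqueDiffOn hSu] at hB ⊢
    obtain ⟨-, B', hB', hd⟩ := hB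
    refine ⟨by simp, fun p => precompCurve L (pullbackCurve L B' p), ?_, fun p hp => ?_⟩
    · exact (precompCurve L).contDiff.comp_contDiffOn (ih hB')
    · exact hasFDerivWithinAt_pullbackCurve hS hL hd hB'.continuousOn hp

lemma contDiffOn_pullbackCurve (hSu : UniqueDiffOn ℝ S)
    (hS : ∀ p ∈ S, ∀ᶠ r in 𝓝[>] (0 : ℝ), Convex ℝ (S ∩ Metric.ball p r))
    (hL : ∀ σ, MapsTo (L σ) S S) {E : Type v} [NormedAddCommGroup E] [NormedSpace ℝ E]
    {B : P → E} (hB : ContDiffOn ℝ ∞ B S) : ContDiffOn ℝ ∞ (pullbackCurve L B) S := by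
  rw [contDiffOn_infty] at hB ⊢
  exact fun k => contDiffOn_pullbackCurve_nat hSu hS hL k (hB k)

end Pullback

/-! ### Volterra operators and invertibility of `1 - V`. -/

section Volterra

variable {F : Type*} [NormedAddCommGroup F] [NormedSpace ℝ F]

/-- The unit interval as the domain of curves. -/
abbrev UnitIcc : Type := Icc (0 : ℝ) 1

/-- Projection of the real line to the unit interval. -/
noncomputable abbrev toUnitIcc (s : ℝ) : UnitIcc := projIcc 0 1 zero_le_one s

lemma continuous_toUnitIcc : Continuous toUnitIcc := continuous_projIcc

lemma continuous_volterra_integrand (K : C(UnitIcc, F →L[ℝ] F)) (f : C(UnitIcc, F)) :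
    Continuous fun s => K (toUnitIcc s) (f (toUnitIcc s)) :=
  (K.continuous.comp continuous_toUnitIcc).clm_apply (f.continuous.comp continuous_toUnitIcc)

/-- The Volterra operator `(V_K f)(t) = ∫₀ᵗ K(s) f(s) ds`. -/
noncomputable def volterra :
    C(UnitIcc, F →L[ℝ] F) →L[ℝ] C(UnitIcc, F) →L[ℝ] C(UnitIcc, F) :=
  LinearMap.mkContinuous₂
    (LinearMap.mk₂ ℝ (fun K f => (⟨fun t : UnitIcc => ∫ s in (0 : ℝ)..t,
        K (toUnitIcc s) (f (toUnitIcc s)),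
        (continuous_primitive (fun _ _ =>
          (continuous_volterra_integrand K f).intervalIntegrable _ _) 0).comp
          continuous_subtype_val⟩ : C(UnitIcc, F)))
      (fun K K' f => by
        ext t
        simp [integral_add ((continuous_volterra_integrand K f).intervalIntegrable _ _)
          ((continuous_volterra_integrand K' f).intervalIntegrable _ _)])
      (fun c K f => by ext t; simp)
      (fun K f f' => by
        ext t
        simp [integral_add ((continuous_volterra_integrand K f).intervalIntegrable _ _)
          ((continuous_volterra_integrand K f').intervalIntegrable _ _)])
      (fun c K f => by ext t; simp)) 1
    (fun K f => by
      rw [ContinuousMap.norm_le _ (by positivity)]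
      intro t
      have := norm_integral_le_of_norm_le_const (a := 0) (b := (t : ℝ)) (C := ‖K‖ * ‖f‖)
        (f := fun s => K (toUnitIcc s) (f (toUnitIcc s))) fun s _ =>
          (K (toUnitIcc s)).le_of_opNorm_le_of_le (K.norm_coe_le_norm _) (f.norm_coe_le_norm _)
      refine this.trans ?_
      rw [one_mul, sub_zero, abs_of_nonneg t.2.1]
      exact mul_le_of_le_one_right (by positivity) t.2.2)

lemma volterra_apply (K : C(UnitIcc, F →L[ℝ] F)) (f : C(UnitIcc, F)) (t : UnitIcc) :
    volterra K f t = ∫ s in (0 : ℝ)..t, K (toUnitIcc s) (f (toUnitIcc s)) := rfl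

/-- The pointwise bound retains the factor `t ^ k`; integrating it once more produces the next
factorial. -/
lemma norm_volterra_pow_apply_le (K : C(UnitIcc, F →L[ℝ] F)) (f : C(UnitIcc, F)) (k : ℕ)
    (t : UnitIcc) : ‖(volterra K ^ k) f t‖ ≤ (‖K‖ * t) ^ k / k.factorial * ‖f‖ := by
  induction k generalizing t with
  | zero => simpa using f.norm_coe_le_norm t
  | succ k ih =>
    rw [pow_succ', mul_apply_eq_comp, volterra_apply]
    have h0 := t.2.1
    have hle : ∀ s ∈ Ioc (0 : ℝ) t, ‖K (toUnitIcc s) ((volterra K ^ k) f (toUnitIcc s))‖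
        ≤ ‖K‖ ^ (k + 1) / k.factorial * ‖f‖ * s ^ k := by
      intro s hs
      have hs' : ((toUnitIcc s : UnitIcc) : ℝ) = s := by
        rw [toUnitIcc, projIcc_of_mem _ ⟨hs.1.le, hs.2.trans t.2.2⟩]
      have h1 := (K (toUnitIcc s)).le_of_opNorm_le_of_le (K.norm_coe_le_norm _)
        (ih (toUnitIcc s))
      rw [hs'] at h1
      refine h1.trans (le_of_eq ?_)
      ring
    refine (norm_integral_le_of_norm_le h0 (Eventually.of_forall hle)
      (by apply Continuous.intervalIntegrable; fun_prop)).trans (le_of_eq ?_)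
    rw [integral_const_mul, integral_pow, Nat.factorial_succ]
    push_cast
    field_simp
    ring

/-- No smallness of `K` is needed: `‖V ^ k‖ ≤ ‖K‖ ^ k / k!` is below `1` for some `k`, so `1 - V ^
k` is a unit. -/
lemma isUnit_one_sub_volterra [CompleteSpace F] (K : C(UnitIcc, F →L[ℝ] F)) :
    IsUnit (1 - volterra K) := by
  have hlim := FloorSemiring.tendsto_pow_div_factorial_atTop ‖K‖
  obtain ⟨k, hk⟩ := (hlim.eventually (gt_mem_nhds one_pos)).exists
  have hnorm : ‖volterra K ^ k‖ < 1 := by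
    refine lt_of_le_of_lt (ContinuousLinearMap.opNorm_le_bound _ (by positivity) fun f => ?_) hk
    rw [ContinuousMap.norm_le _ (by positivity)]
    intro t
    refine (norm_volterra_pow_apply_le K f k t).trans ?_
    have h0 := t.2.1
    gcongr
    exact mul_le_of_le_one_right (by positivity) t.2.2
  have hu : IsUnit (1 - volterra K ^ k) :=
    isUnit_one_sub_of_norm_lt_one (R := C(UnitIcc, F) →L[ℝ] C(UnitIcc, F)) hnorm
  -- `1 - V ^ k` is `1 - V` times a geometric sum commuting with it, and commuting factors of a unit
  -- are units.
  rw [← mul_neg_geom_sum] at hu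
  exact (Commute.isUnit_mul_iff (Commute.sum_right _ _ _ fun i _ =>
    ((Commute.one_left _).sub_left (Commute.refl _)).pow_right i)).1 hu |>.1

end Volterra

/-! ### Linear ODEs with parameters: uniqueness, existence, joint smoothness. -/

section LinearODE

/-- The operator norms of `A` are bounded on the compact interval, which gives the uniform Lipschitz
constant for the Grönwall argument. -/
lemma linear_ODE_unique {F : Type*} [NormedAddCommGroup F] [NormedSpace ℝ F]
    {A : ℝ → F →L[ℝ] F} {T : ℝ} (hA : ContinuousOn A (Icc 0 T)) {f g : ℝ → F}
    (hf : ∀ t ∈ Icc 0 T, HasDerivWithinAt f (A t (f t)) (Icc 0 T) t)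
    (hg : ∀ t ∈ Icc 0 T, HasDerivWithinAt g (A t (g t)) (Icc 0 T) t) (h0 : f 0 = g 0) :
    EqOn f g (Icc 0 T) := by
  obtain ⟨C, hC⟩ := isCompact_Icc.exists_bound_of_continuousOn hA
  have aux : ∀ h : ℝ → F, (∀ t ∈ Icc 0 T, HasDerivWithinAt h (A t (h t)) (Icc 0 T) t) →
      ∀ t ∈ Ico 0 T, HasDerivWithinAt h (A t (h t)) (Ici t) t := fun h hh t ht =>
    (hh t (Ico_subset_Icc_self ht)).mono_of_mem_nhdsWithin
      (mem_of_superset (Icc_mem_nhdsGE ht.2) (Icc_subset_Icc_left ht.1))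
  refine ODE_solution_unique_of_mem_Icc_right (v := fun t x => A t x) (s := fun _ => univ)
    (K := C.toNNReal) (fun t ht => ?_) (fun t ht => (hf t ht).continuousWithinAt) (aux f hf)
    (fun _ _ => mem_univ _) (fun t ht => (hg t ht).continuousWithinAt) (aux g hg)
    (fun _ _ => mem_univ _) h0
  refine ((A t).lipschitz.weaken ?_).lipschitzOnWith
  rw [← norm_toNNReal]
  exact Real.toNNReal_le_toNNReal (hC t (Ico_subset_Icc_self ht))

universe v
variable {X F : Type v} [NormedAddCommGroup X] [NormedSpace ℝ X]
  [NormedAddCommGroup F] [NormedSpace ℝ F]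

/-- The family of linear maps `(τ, u) ↦ (σ τ, u)`, `0 ≤ σ ≤ 1`. -/
noncomputable def timeScaling (X : Type v) [NormedAddCommGroup X] [NormedSpace ℝ X] :
    C(UnitIcc, ℝ × X →L[ℝ] ℝ × X) where
  toFun σ := (σ : ℝ) • (ContinuousLinearMap.inl ℝ ℝ X).comp (ContinuousLinearMap.fst ℝ ℝ X)
    + (ContinuousLinearMap.inr ℝ ℝ X).comp (ContinuousLinearMap.snd ℝ ℝ X)
  continuous_toFun := by fun_prop

lemma timeScaling_apply (σ : UnitIcc) (p : ℝ × X) :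
    timeScaling X σ p = ((σ : ℝ) * p.1, p.2) := by
  ext <;> simp [timeScaling]

lemma timeScaling_mapsTo (U : Set X) (τ₀ : ℝ) (σ : UnitIcc) :
    MapsTo (timeScaling X σ) (Ico 0 τ₀ ×ˢ U) (Ico 0 τ₀ ×ˢ U) := by
  rintro ⟨τ, u⟩ ⟨⟨h0, h1⟩, hu⟩
  rw [timeScaling_apply]
  exact ⟨⟨mul_nonneg σ.2.1 h0, (mul_le_of_le_one_left h0 σ.2.2).trans_lt h1⟩, hu⟩

/-- `U` need not be convex, but in the sup metric of a product a small ball cuts out an interval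
times a ball contained in `U`. -/
lemma eventually_convex_Ico_prod_inter_ball {U : Set X} (hU : IsOpen U) (τ₀ : ℝ) :
    ∀ p ∈ Ico 0 τ₀ ×ˢ U, ∀ᶠ r in 𝓝[>] (0 : ℝ), Convex ℝ (Ico 0 τ₀ ×ˢ U ∩ Metric.ball p r) := by
  rintro ⟨τ, u⟩ ⟨-, hu⟩
  obtain ⟨ε, hε, hεU⟩ := Metric.isOpen_iff.1 hU u hu
  filter_upwards [Ioo_mem_nhdsGT hε] with r hr
  have : Ico 0 τ₀ ×ˢ U ∩ Metric.ball (τ, u) r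
      = (Ico 0 τ₀ ∩ Metric.ball τ r) ×ˢ Metric.ball u r := by
    rw [← ball_prod_same, prod_inter_prod,
      inter_eq_self_of_subset_right ((Metric.ball_subset_ball hr.2.le).trans hεU)]
  rw [this]
  exact ((convex_Ico _ _).inter (convex_ball _ _)).prod (convex_ball _ _)

lemma uniqueDiffOn_Ico_prod {U : Set X} (hU : IsOpen U) (τ₀ : ℝ) :
    UniqueDiffOn ℝ (Ico 0 τ₀ ×ˢ U) :=
  (uniqueDiffOn_Ico 0 τ₀).prod hU.uniqueDiffOn

variable [CompleteSpace F]

/-- The rescaled solution `σ ↦ x(σ τ, u)`, `0 ≤ σ ≤ 1`, of `x' = A x`, `x(0, u) = x₀(u)`. -/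
noncomputable def linearFlowCurve (A : ℝ × X → F →L[ℝ] F) (x₀ : X → F) (p : ℝ × X) :
    C(UnitIcc, F) :=
  Ring.inverse (1 - volterra (p.1 • pullbackCurve (timeScaling X) A p))
    (ContinuousMap.const _ (x₀ p.2))

/-- The solution of the linear equation `x' = A x`, `x(0, u) = x₀(u)`. -/
noncomputable def linearFlow (A : ℝ × X → F →L[ℝ] F) (x₀ : X → F) (p : ℝ × X) : F :=
  linearFlowCurve A x₀ p 1

variable {U : Set X} {τ₀ : ℝ} {A : ℝ × X → F →L[ℝ] F} {x₀ : X → F}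

lemma contDiffOn_linearFlow (hU : IsOpen U) (hA : ContDiffOn ℝ ∞ A (Ico 0 τ₀ ×ˢ U))
    (hx₀ : ContDiffOn ℝ ∞ x₀ U) : ContDiffOn ℝ ∞ (linearFlow A x₀) (Ico 0 τ₀ ×ˢ U) := by
  have h1 : ContDiffOn ℝ ∞ (pullbackCurve (timeScaling X) A) (Ico 0 τ₀ ×ˢ U) :=
    contDiffOn_pullbackCurve (uniqueDiffOn_Ico_prod hU τ₀)
      (eventually_convex_Ico_prod_inter_ball hU τ₀) (timeScaling_mapsTo U τ₀) hA
  have h2 : ContDiffOn ℝ ∞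
      (fun p : ℝ × X => 1 - volterra (p.1 • pullbackCurve (timeScaling X) A p))
      (Ico 0 τ₀ ×ˢ U) := by
    have hv : ContDiff ℝ ∞ (fun K : C(UnitIcc, F →L[ℝ] F) => volterra K) := by fun_prop
    exact contDiffOn_const.sub (hv.comp_contDiffOn (contDiff_fst.contDiffOn.smul h1))
  have h3 : ContDiffOn ℝ ∞
      (fun p : ℝ × X => Ring.inverse (1 - volterra (p.1 • pullbackCurve (timeScaling X) A p)))
      (Ico 0 τ₀ ×ˢ U) := by
    intro p hp
    obtain ⟨w, hw⟩ := isUnit_one_sub_volterra (p.1 • pullbackCurve (timeScaling X) A p)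
    have := contDiffAt_ringInverse ℝ (n := ∞) (R := C(UnitIcc, F) →L[ℝ] C(UnitIcc, F)) w
    rw [hw] at this
    exact this.comp_contDiffWithinAt p (h2 p hp)
  have h4 : ContDiffOn ℝ ∞ (fun p : ℝ × X => ContinuousMap.const UnitIcc (x₀ p.2))
      (Ico 0 τ₀ ×ˢ U) :=
    (ContinuousLinearMap.const ℝ UnitIcc : F →L[ℝ] C(UnitIcc, F)).contDiff.comp_contDiffOn
      (hx₀.comp contDiffOn_snd fun p hp => hp.2)
  exact (ContinuousMap.evalCLM ℝ (1 : UnitIcc) : C(UnitIcc, F) →L[ℝ] F).contDiff.comp_contDiffOn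
    (h3.clm_apply h4)

/-- Since `1 - V` is a unit, `Ring.inverse` is a true inverse here, and the defining equation
becomes the integral equation in rescaled time. -/
lemma linearFlowCurve_eq (hA : ContinuousOn A (Ico 0 τ₀ ×ˢ U)) {p : ℝ × X}
    (hp : p ∈ Ico 0 τ₀ ×ˢ U) (σ : UnitIcc) :
    linearFlowCurve A x₀ p σ = x₀ p.2 + ∫ s in (0 : ℝ)..σ,
      p.1 • A (toUnitIcc s * p.1, p.2) (linearFlowCurve A x₀ p (toUnitIcc s)) := by
  set K := p.1 • pullbackCurve (timeScaling X) A p with hK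
  have h1 : (1 - volterra K) (linearFlowCurve A x₀ p) = ContinuousMap.const _ (x₀ p.2) := by
    rw [linearFlowCurve, ← mul_apply_eq_comp,
      Ring.mul_inverse_cancel _ (isUnit_one_sub_volterra K)]
    rfl
  have h2 := DFunLike.congr_fun h1 σ
  have h3 : linearFlowCurve A x₀ p σ - volterra K (linearFlowCurve A x₀ p) σ = x₀ p.2 := h2
  rw [← h3, volterra_apply]
  have h4 : ∀ s, K (toUnitIcc s) = p.1 • A (toUnitIcc s * p.1, p.2) := by
    intro s
    rw [hK, ContinuousMap.smul_apply, pullbackCurve_apply hA (timeScaling_mapsTo U τ₀) hp,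
      timeScaling_apply]
  simp [h4]

lemma linearFlow_zero (hA : ContinuousOn A (Ico 0 τ₀ ×ˢ U)) (hτ₀ : 0 < τ₀) {u : X}
    (hu : u ∈ U) : linearFlow A x₀ (0, u) = x₀ u := by
  rw [linearFlow, linearFlowCurve_eq hA (by simp [hτ₀, hu])]
  simp

lemma hasDerivWithinAt_linearFlowCurve (hA : ContinuousOn A (Ico 0 τ₀ ×ˢ U)) {T : ℝ}
    (hT : T ∈ Ioo 0 τ₀) {u : X} (hu : u ∈ U) {t : ℝ} (ht : t ∈ Icc 0 T) :
    HasDerivWithinAt (fun s => linearFlowCurve A x₀ (T, u) (toUnitIcc (s / T)))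
      (A (t, u) (linearFlowCurve A x₀ (T, u) (toUnitIcc (t / T)))) (Icc 0 T) t := by
  have hp : (T, u) ∈ Ico 0 τ₀ ×ˢ U := ⟨⟨hT.1.le, hT.2⟩, hu⟩
  have hmem : ∀ s ∈ Icc 0 T, s / T ∈ Icc (0 : ℝ) 1 := fun s hs =>
    ⟨div_nonneg hs.1 hT.1.le, (div_le_one hT.1).2 hs.2⟩
  have hval : ∀ s ∈ Icc 0 T, ((toUnitIcc (s / T) : UnitIcc) : ℝ) = s / T := fun s hs => by
    rw [toUnitIcc, projIcc_of_mem _ (hmem s hs)]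
  set y := linearFlowCurve A x₀ (T, u) with hy
  set G : ℝ → F := fun s => T • A (toUnitIcc s * T, u) (y (toUnitIcc s)) with hG
  have hmaps : ∀ s : ℝ, ((toUnitIcc s : UnitIcc) * T, u) ∈ Ico 0 τ₀ ×ˢ U := fun s => by
    simpa [timeScaling_apply] using timeScaling_mapsTo U τ₀ (toUnitIcc s) hp
  have hGc : Continuous G := by
    have hc := continuous_toUnitIcc
    refine Continuous.const_smul (Continuous.clm_apply ?_ (y.continuous.comp hc)) T
    exact hA.comp_continuous (by fun_prop) hmaps
  have hd : HasDerivAt (fun σ : ℝ => x₀ u + ∫ s in (0 : ℝ)..σ, G s) (G (t / T)) (t / T) :=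
    (hGc.integral_hasStrictDerivAt 0 _).hasDerivAt.const_add _
  have hd' := hd.scomp t ((hasDerivAt_id t).div_const T)
  have hT0 := hT.1.ne'
  have hderiv : (1 / T) • G (t / T) = A (t, u) (y (toUnitIcc (t / T))) := by
    rw [hG]
    simp only
    rw [hval t ht, smul_smul, one_div_mul_cancel hT0, one_smul, div_mul_cancel₀ _ hT0]
  rw [← hderiv]
  have heq : ∀ s ∈ Icc 0 T, y (toUnitIcc (s / T)) = x₀ u + ∫ s in (0 : ℝ)..(s / T), G s := by
    intro s hs
    rw [hy, linearFlowCurve_eq hA hp, hval s hs]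
  exact hd'.hasDerivWithinAt.congr heq (heq t ht)

/-- `linearFlow` at time `t` is the endpoint of a curve rescaled by `t` itself, so differentiating
in `t` would change the curve. Uniqueness identifies all these endpoints with values of one curve on
`[0, T]`. -/
lemma linearFlowCurve_eq_linearFlow (hA : ContinuousOn A (Ico 0 τ₀ ×ˢ U)) {T : ℝ}
    (hT : T ∈ Ioo 0 τ₀) {u : X} (hu : u ∈ U) {t : ℝ} (ht : t ∈ Icc 0 T) :
    linearFlow A x₀ (t, u) = linearFlowCurve A x₀ (T, u) (toUnitIcc (t / T)) := by
  have hz : toUnitIcc (0 : ℝ) = ⟨0, by simp⟩ := projIcc_of_mem _ (by simp)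
  have h0 : ∀ T ∈ Ioo 0 τ₀, linearFlowCurve A x₀ (T, u) (toUnitIcc (0 / T)) = x₀ u := by
    intro T hT
    rw [zero_div, hz, linearFlowCurve_eq hA ⟨⟨hT.1.le, hT.2⟩, hu⟩]
    simp
  -- At `t = 0` the rescaling degenerates, so the initial values are compared directly.
  rcases ht.1.eq_or_lt with rfl | htpos
  · rw [linearFlow_zero hA (hT.1.trans hT.2) hu, h0 T hT]
  have ht' : t ∈ Ioo 0 τ₀ := ⟨htpos, ht.2.trans_lt hT.2⟩
  have hsub : Icc 0 t ⊆ Icc 0 T := Icc_subset_Icc_right ht.2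
  have hcont : ContinuousOn (fun s => A (s, u)) (Icc 0 t) :=
    hA.comp (by fun_prop) fun s hs => ⟨⟨hs.1, hs.2.trans_lt ht'.2⟩, hu⟩
  have := linear_ODE_unique hcont
    (fun s hs => hasDerivWithinAt_linearFlowCurve (x₀ := x₀) hA ht' hu hs)
    (fun s hs => (hasDerivWithinAt_linearFlowCurve (x₀ := x₀) hA hT hu (hsub hs)).mono hsub)
    (by rw [h0 t ht', h0 T hT]) ⟨htpos.le, le_rfl⟩
  refine Eq.trans ?_ this
  simp only
  rw [div_self htpos.ne', linearFlow]
  congr 1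
  exact (projIcc_right _).symm

lemma hasDerivWithinAt_linearFlow (hA : ContinuousOn A (Ico 0 τ₀ ×ˢ U)) {u : X} (hu : u ∈ U)
    {t : ℝ} (ht : t ∈ Ico 0 τ₀) :
    HasDerivWithinAt (fun s => linearFlow A x₀ (s, u)) (A (t, u) (linearFlow A x₀ (t, u)))
      (Ico 0 τ₀) t := by
  -- `T` lies strictly beyond `t`, so `[0, T]` is a neighbourhood of `t` within `[0, τ₀)`.
  obtain ⟨T, htT, hTτ⟩ := exists_between ht.2
  have hT : T ∈ Ioo 0 τ₀ := ⟨ht.1.trans_lt htT, hTτ⟩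
  have ht' : t ∈ Icc 0 T := ⟨ht.1, htT.le⟩
  have h := hasDerivWithinAt_linearFlowCurve (x₀ := x₀) hA hT hu ht'
  rw [← linearFlowCurve_eq_linearFlow hA hT hu ht'] at h
  have h' := h.congr (fun s hs => linearFlowCurve_eq_linearFlow hA hT hu hs)
    (linearFlowCurve_eq_linearFlow hA hT hu ht')
  refine h'.mono_of_mem_nhdsWithin ?_
  filter_upwards [inter_mem_nhdsWithin (Ico 0 τ₀) (Iio_mem_nhds htT)] with s hs
  exact ⟨hs.1.1, hs.2.le⟩

/-- Linear equations with smooth coefficients and smooth initial values have smooth solutions,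
jointly in time and parameters. -/
theorem exists_contDiffOn_linear_ODE (hU : IsOpen U) (hτ₀ : 0 < τ₀)
    (hA : ContDiffOn ℝ ∞ A (Ico 0 τ₀ ×ˢ U)) (hx₀ : ContDiffOn ℝ ∞ x₀ U) :
    ∃ x : ℝ × X → F, ContDiffOn ℝ ∞ x (Ico 0 τ₀ ×ˢ U) ∧ (∀ u ∈ U, x (0, u) = x₀ u) ∧
      ∀ u ∈ U, ∀ t ∈ Ico 0 τ₀,
        HasDerivWithinAt (fun s => x (s, u)) (A (t, u) (x (t, u))) (Ico 0 τ₀) t :=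
  ⟨linearFlow A x₀, contDiffOn_linearFlow hU hA hx₀,
    fun _ hu => linearFlow_zero hA.continuousOn hτ₀ hu,
    fun _ hu _ ht => hasDerivWithinAt_linearFlow hA.continuousOn hu ht⟩

end LinearODE

/-! ### Entrywise calculus for matrix-valued functions of time. -/

section MatrixCalculus

variable {ι κ μ : Type} [Fintype κ]

lemma hasDerivWithinAt_matrix_mul {X : ℝ → Matrix ι κ ℝ} {Y : ℝ → Matrix κ μ ℝ}
    {X' : Matrix ι κ ℝ} {Y' : Matrix κ μ ℝ} {s : Set ℝ} {t : ℝ}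
    (hX : ∀ i j, HasDerivWithinAt (fun r => X r i j) (X' i j) s t)
    (hY : ∀ i j, HasDerivWithinAt (fun r => Y r i j) (Y' i j) s t) (i : ι) (j : μ) :
    HasDerivWithinAt (fun r => (X r * Y r) i j) ((X' * Y t + X t * Y') i j) s t := by
  simp only [Matrix.mul_apply, Matrix.add_apply, ← Finset.sum_add_distrib]
  exact HasDerivWithinAt.fun_sum fun k _ => (hX i k).mul (hY k j)

lemma eq_initial_of_hasDerivWithinAt_zero {τ₀ : ℝ} {f : ℝ → ℝ}
    (hf : ∀ t ∈ Ico 0 τ₀, HasDerivWithinAt f 0 (Ico 0 τ₀) t) {t : ℝ} (ht : t ∈ Ico 0 τ₀) :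
    f t = f 0 := by
  have := (convex_Ico 0 τ₀).norm_image_sub_le_of_norm_hasDerivWithin_le (C := 0) hf
    (fun _ _ => by simp) ⟨le_rfl, ht.1.trans_lt ht.2⟩ ht
  simpa [sub_eq_zero] using this

lemma hasDerivWithinAt_Ico_unique {τ₀ : ℝ} {f : ℝ → ℝ} {a b t : ℝ} (ht : t ∈ Ico 0 τ₀)
    (ha : HasDerivWithinAt f a (Ico 0 τ₀) t) (hb : HasDerivWithinAt f b (Ico 0 τ₀) t) : a = b :=
  (uniqueDiffOn_Ico 0 τ₀ t ht).eq_deriv _ ha hb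

/-- Right multiplication by `M` acts on each row separately, so this is vector-valued uniqueness row
by row. -/
lemma matrix_linear_ODE_unique [DecidableEq κ] {τ₀ : ℝ} {M : ℝ → Matrix κ κ ℝ}
    (hM : ∀ i j, ContinuousOn (fun t => M t i j) (Ico 0 τ₀)) {X Y : ℝ → Matrix ι κ ℝ}
    (hX : ∀ t ∈ Ico 0 τ₀, ∀ i j,
      HasDerivWithinAt (fun s => X s i j) ((X t * M t) i j) (Ico 0 τ₀) t)
    (hY : ∀ t ∈ Ico 0 τ₀, ∀ i j,
      HasDerivWithinAt (fun s => Y s i j) ((Y t * M t) i j) (Ico 0 τ₀) t)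
    (h0 : X 0 = Y 0) {t : ℝ} (ht : t ∈ Ico 0 τ₀) : X t = Y t := by
  have hsub : Icc 0 t ⊆ Ico 0 τ₀ := fun s hs => ⟨hs.1, hs.2.trans_lt ht.2⟩
  ext i j
  have hA : ContinuousOn (fun s => (Matrix.vecMulLinear (M s)).toContinuousLinearMap)
      (Icc 0 t) := by
    rw [continuousOn_clm_apply]
    intro y
    simp only [LinearMap.coe_toContinuousLinearMap', Matrix.vecMulLinear_apply]
    refine continuousOn_pi.2 fun k => ?_
    simp only [Matrix.vecMul, dotProduct]
    exact continuousOn_finsetSum _ fun l _ => continuousOn_const.mul ((hM l k).mono hsub)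
  have aux : ∀ Z : ℝ → Matrix ι κ ℝ, (∀ t ∈ Ico 0 τ₀, ∀ i j,
      HasDerivWithinAt (fun s => Z s i j) ((Z t * M t) i j) (Ico 0 τ₀) t) →
      ∀ s ∈ Icc 0 t, HasDerivWithinAt (fun s => Z s i)
        ((Matrix.vecMulLinear (M s)).toContinuousLinearMap (Z s i)) (Icc 0 t) s := by
    intro Z hZ s hs
    rw [hasDerivWithinAt_pi]
    exact fun k => (hZ s (hsub hs) i k).mono hsub
  have := linear_ODE_unique hA (aux X hX) (aux Y hY) (by rw [h0]) ⟨ht.1, le_rfl⟩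
  exact congrFun this j

end MatrixCalculus

/-! ### Smooth families of matrices. -/

namespace NAnholonomic

variable {n m : ℕ} {U : Set (Coord n m)} {τ₀ : ℝ} {ι κ μ : Type}

lemma SmoothFamily.mul [Fintype κ] {X : ℝ → Coord n m → Matrix ι κ ℝ}
    {Y : ℝ → Coord n m → Matrix κ μ ℝ} (hX : SmoothFamily U τ₀ X) (hY : SmoothFamily U τ₀ Y) :
    SmoothFamily U τ₀ fun τ u => X τ u * Y τ u := by
  intro i j
  simp only [Matrix.mul_apply]
  exact ContDiffOn.sum fun k _ => (hX i k).mul (hY k j)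

lemma SmoothFamily.transpose {X : ℝ → Coord n m → Matrix ι κ ℝ} (hX : SmoothFamily U τ₀ X) :
    SmoothFamily U τ₀ fun τ u => (X τ u)ᵀ := fun i j => hX j i

lemma SmoothFamily.const (C : Matrix ι κ ℝ) :
    SmoothFamily (n := n) (m := m) U τ₀ fun _ _ => C := fun _ _ => contDiffOn_const

lemma SmoothFamily.neg {X : ℝ → Coord n m → Matrix ι κ ℝ} (hX : SmoothFamily U τ₀ X) :
    SmoothFamily U τ₀ fun τ u => -X τ u := fun i j => (hX i j).neg

lemma SmoothFamily.fromBlocks {ι' κ' : Type} {A : ℝ → Coord n m → Matrix ι κ ℝ}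
    {B : ℝ → Coord n m → Matrix ι κ' ℝ} {C : ℝ → Coord n m → Matrix ι' κ ℝ}
    {D : ℝ → Coord n m → Matrix ι' κ' ℝ} (hA : SmoothFamily U τ₀ A) (hB : SmoothFamily U τ₀ B)
    (hC : SmoothFamily U τ₀ C) (hD : SmoothFamily U τ₀ D) :
    SmoothFamily U τ₀ fun τ u => Matrix.fromBlocks (A τ u) (B τ u) (C τ u) (D τ u) := by
  rintro (i | i) (j | j)
  exacts [hA i j, hB i j, hC i j, hD i j]

lemma SmoothFamily.det [Fintype ι] [DecidableEq ι] {X : ℝ → Coord n m → Matrix ι ι ℝ}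
    (hX : SmoothFamily U τ₀ X) :
    ContDiffOn ℝ ∞ (fun p : ℝ × Coord n m => (X p.1 p.2).det) (Ico 0 τ₀ ×ˢ U) := by
  simp only [Matrix.det_apply]
  exact ContDiffOn.sum fun σ _ => (contDiffOn_prod fun i _ => hX (σ i) i).const_smul _

lemma SmoothFamily.inv [Fintype ι] [DecidableEq ι] {X : ℝ → Coord n m → Matrix ι ι ℝ}
    (hX : SmoothFamily U τ₀ X) (hdet : ∀ τ ∈ Ico 0 τ₀, ∀ u ∈ U, (X τ u).det ≠ 0) :
    SmoothFamily U τ₀ fun τ u => (X τ u)⁻¹ := by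
  intro i j
  simp only [Matrix.inv_def, Matrix.smul_apply, Ring.inverse_eq_inv', smul_eq_mul,
    Matrix.adjugate_apply]
  refine (hX.det.inv fun p hp => hdet p.1 hp.1 p.2 hp.2).mul
    (SmoothFamily.det (X := fun τ u => (X τ u).updateRow j (Pi.single i 1)) fun k l => ?_)
  by_cases hk : k = j
  · subst hk
    simpa using contDiffOn_const
  · simpa [Matrix.updateRow_ne hk] using hX k l

/-- The `τ`-derivative is the full derivative within `[0, τ₀) × U` applied to the vector `(1, 0)`.
This later yields smoothness of the Ricci blocks from the flow equation alone. -/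
lemma SmoothFamily.of_hasDerivWithinAt (hU : IsOpen U) {X X' : ℝ → Coord n m → Matrix ι κ ℝ}
    (hX : SmoothFamily U τ₀ X) (hX' : ∀ τ ∈ Ico 0 τ₀, ∀ u ∈ U, ∀ i j,
      HasDerivWithinAt (fun s => X s u i j) (X' τ u i j) (Ico 0 τ₀) τ) :
    SmoothFamily U τ₀ X' := by
  intro i j
  have hS := uniqueDiffOn_Ico_prod hU τ₀
  have hd := (hX i j).fderivWithin hS (m := ∞) (by simp)
  refine (hd.clm_apply (contDiffOn_const (c := ((1 : ℝ), (0 : Coord n m))))).congr ?_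
  rintro ⟨τ, u⟩ ⟨hτ, hu⟩
  have h1 := ((hX i j).differentiableOn (by simp) (τ, u) ⟨hτ, hu⟩).hasFDerivWithinAt
  have h2 : HasDerivWithinAt (fun s : ℝ => (s, u)) ((1 : ℝ), (0 : Coord n m)) (Ico 0 τ₀) τ :=
    (hasDerivWithinAt_id τ _).prodMk (hasDerivWithinAt_const τ _ u)
  have hmaps : MapsTo (fun s => (s, u)) (Ico 0 τ₀) (Ico 0 τ₀ ×ˢ U) := fun _ hs => ⟨hs, hu⟩
  have h3 := h1.comp_hasDerivWithinAt τ h2 hmaps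
  exact hasDerivWithinAt_Ico_unique hτ (hX' τ hτ u hu i j) h3

lemma SmoothFamily.continuousOn_time {X : ℝ → Coord n m → Matrix ι κ ℝ}
    (hX : SmoothFamily U τ₀ X) {u : Coord n m} (hu : u ∈ U) (i : ι) (j : κ) :
    ContinuousOn (fun t => X t u i j) (Ico 0 τ₀) := by
  have hmaps : MapsTo (fun t => (t, u)) (Ico 0 τ₀) (Ico 0 τ₀ ×ˢ U) := fun _ ht => ⟨ht, hu⟩
  exact (hX i j).continuousOn.comp (by fun_prop) hmaps

lemma SmoothFamily.hasDerivWithinAt {X : ℝ → Coord n m → Matrix ι κ ℝ}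
    (hX : SmoothFamily U τ₀ X) {u : Coord n m} (hu : u ∈ U) {τ : ℝ} (hτ : τ ∈ Ico 0 τ₀)
    (i : ι) (j : κ) : HasDerivWithinAt (fun s => X s u i j)
      (derivWithin (fun s => X s u i j) (Ico 0 τ₀) τ) (Ico 0 τ₀) τ := by
  refine DifferentiableWithinAt.hasDerivWithinAt ?_
  exact ((hX i j).differentiableOn (by simp) (τ, u) ⟨hτ, hu⟩).comp τ (f := fun s => (s, u))
    (by fun_prop) fun s hs => ⟨hs, hu⟩

lemma exists_smoothFamily_linear_ODE [Finite ι] [Fintype κ] [DecidableEq κ] (hU : IsOpen U)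
    (hτ₀ : 0 < τ₀) {M : ℝ → Coord n m → Matrix κ κ ℝ} (hM : SmoothFamily U τ₀ M)
    {X₀ : Coord n m → Matrix ι κ ℝ} (hX₀ : ∀ i j, ContDiffOn ℝ ∞ (fun u => X₀ u i j) U) :
    ∃ X : ℝ → Coord n m → Matrix ι κ ℝ, SmoothFamily U τ₀ X ∧ (∀ u ∈ U, X 0 u = X₀ u) ∧
      ∀ τ ∈ Ico 0 τ₀, ∀ u ∈ U, ∀ i j,
        HasDerivWithinAt (fun s => X s u i j) ((X τ u * M τ u) i j) (Ico 0 τ₀) τ := by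
  have hA : ContDiffOn ℝ ∞ (fun p : ℝ × Coord n m =>
      (Matrix.vecMulLinear (M p.1 p.2)).toContinuousLinearMap) (Ico 0 τ₀ ×ˢ U) := by
    rw [contDiffOn_clm_apply]
    intro y
    simp only [LinearMap.coe_toContinuousLinearMap', Matrix.vecMulLinear_apply]
    refine contDiffOn_pi.2 fun k => ?_
    simp only [Matrix.vecMul, dotProduct]
    exact ContDiffOn.sum fun l _ => contDiffOn_const.mul (hM l k)
  have hrow := fun i => exists_contDiffOn_linear_ODE hU hτ₀ hA (contDiffOn_pi.2 (hX₀ i))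
  choose x hx hx0 hxd using hrow
  refine ⟨fun τ u => Matrix.of fun i => x i (τ, u), fun i j => contDiffOn_pi.1 (hx i) j,
    fun u hu => ?_, fun τ hτ u hu i j => ?_⟩
  · ext i j
    exact congrFun (hx0 i u hu) j
  · exact hasDerivWithinAt_pi.1 (hxd i u hu τ hτ) j

end NAnholonomic

/-! ### Linear algebra of preferred frames. -/

namespace NAnholonomic

section Algebra

variable {n m : ℕ}

lemma diagonal_sign_mul_self {ι : Type} [Fintype ι] [DecidableEq ι] {η : ι → ℝ}
    (hη : ∀ i, η i = 1 ∨ η i = -1) : Matrix.diagonal η * Matrix.diagonal η = 1 := by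
  rw [Matrix.diagonal_mul_diagonal, ← Matrix.diagonal_one]
  congr 1
  ext i
  rcases hη i with h | h <;> simp [h]

/-- Because `η² = 1`, orthonormality supplies an explicit inverse of `P`, polynomial in `g` and `P`.
-/
lemma mul_eq_one_of_orthonormal {ι : Type} [Fintype ι] [DecidableEq ι] {η : ι → ℝ}
    (hη : ∀ i, η i = 1 ∨ η i = -1) {P g : Matrix ι ι ℝ} (h : P * g * Pᵀ = Matrix.diagonal η) :
    P * (g * Pᵀ * Matrix.diagonal η) = 1 := by
  rw [← diagonal_sign_mul_self hη, ← Matrix.mul_assoc, ← Matrix.mul_assoc, h]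

lemma toAdapted_mul_toAdapted_neg (N : Matrix (Fin m) (Fin n) ℝ) :
    toAdapted N * toAdapted (-N) = 1 := by
  simp [toAdapted, Matrix.fromBlocks_multiply, Matrix.fromBlocks_one]

lemma frameMatrix_mul_toAdapted (N : Matrix (Fin m) (Fin n) ℝ) (P : Matrix (Fin n) (Fin n) ℝ)
    (Q : Matrix (Fin m) (Fin m) ℝ) :
    frameMatrix N P Q * toAdapted N = Matrix.fromBlocks P 0 0 Q := by
  simp [frameMatrix, toAdapted, Matrix.fromBlocks_multiply]

lemma fromBlocks_mul_frameMatrix (N : Matrix (Fin m) (Fin n) ℝ)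
    (Λh P : Matrix (Fin n) (Fin n) ℝ) (Λv Q : Matrix (Fin m) (Fin m) ℝ) :
    Matrix.fromBlocks Λh 0 0 Λv * frameMatrix N P Q = frameMatrix N (Λh * P) (Λv * Q) := by
  simp [frameMatrix, Matrix.fromBlocks_multiply, Matrix.mul_assoc]

lemma frameMatrix_inj {N : Matrix (Fin m) (Fin n) ℝ} {P P' : Matrix (Fin n) (Fin n) ℝ}
    {Q Q' : Matrix (Fin m) (Fin m) ℝ} (h : frameMatrix N P Q = frameMatrix N P' Q') :
    P = P' ∧ Q = Q' := by
  have := Matrix.fromBlocks_inj.1 h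
  exact ⟨this.1, this.2.2.2⟩

lemma dMetric_inv {gh : Matrix (Fin n) (Fin n) ℝ} {gv : Matrix (Fin m) (Fin m) ℝ}
    (hh : gh.det ≠ 0) (hv : gv.det ≠ 0) : (dMetric gh gv)⁻¹ = dMetric gh⁻¹ gv⁻¹ := by
  refine Matrix.inv_eq_right_inv ?_
  simp [dMetric, Matrix.fromBlocks_multiply, Matrix.mul_nonsing_inv _ hh.isUnit,
    Matrix.mul_nonsing_inv _ hv.isUnit, Matrix.fromBlocks_one]

lemma isUnit_det_dMetric {gh : Matrix (Fin n) (Fin n) ℝ} {gv : Matrix (Fin m) (Fin m) ℝ}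
    (hh : gh.det ≠ 0) (hv : gv.det ≠ 0) : IsUnit (dMetric gh gv).det := by
  rw [dMetric, Matrix.det_fromBlocks_zero₂₁]
  exact (mul_ne_zero hh hv).isUnit

variable {ηh : Fin n → ℝ} {ηv : Fin m → ℝ}

/-- In terms of the frame blocks themselves, instead of the coframe blocks, the invertibility
conditions are automatic: orthonormality with respect to a nondegenerate `η` forces them. -/
lemma isPreferredFrame_iff (hηh : ∀ i, ηh i = 1 ∨ ηh i = -1) (hηv : ∀ a, ηv a = 1 ∨ ηv a = -1)
    {gh : Matrix (Fin n) (Fin n) ℝ} {gv : Matrix (Fin m) (Fin m) ℝ}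
    {N : Matrix (Fin m) (Fin n) ℝ} {E : Matrix (Idx n m) (Idx n m) ℝ} :
    IsPreferredFrame ηh ηv gh gv N E ↔ ∃ P Q, E = frameMatrix N P Q ∧
      P * gh * Pᵀ = Matrix.diagonal ηh ∧ Q * gv * Qᵀ = Matrix.diagonal ηv := by
  constructor
  · rintro ⟨A, B, hA, hB, rfl, -, rfl, rfl⟩
    have aux : ∀ {k : ℕ} (A : Matrix (Fin k) (Fin k) ℝ) (η : Fin k → ℝ), IsUnit A.det →
        A⁻¹ * (A * Matrix.diagonal η * Aᵀ) * A⁻¹ᵀ = Matrix.diagonal η := by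
      intro k A η hA
      rw [Matrix.mul_assoc, Matrix.mul_assoc _ Aᵀ, ← Matrix.transpose_mul,
        Matrix.nonsing_inv_mul _ hA, Matrix.transpose_one, Matrix.mul_one,
        ← Matrix.mul_assoc, Matrix.nonsing_inv_mul _ hA, Matrix.one_mul]
    exact ⟨A⁻¹, B⁻¹, rfl, aux A ηh hA, aux B ηv hB⟩
  · rintro ⟨P, Q, rfl, hP, hQ⟩
    have aux : ∀ {k : ℕ} {P g : Matrix (Fin k) (Fin k) ℝ} {η : Fin k → ℝ},
        (∀ i, η i = 1 ∨ η i = -1) → P * g * Pᵀ = Matrix.diagonal η →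
        IsUnit P.det ∧ g = P⁻¹ * Matrix.diagonal η * P⁻¹ᵀ := by
      intro k P g η hη h
      have hu : IsUnit P.det :=
        Matrix.isUnit_det_of_right_inverse (mul_eq_one_of_orthonormal hη h)
      refine ⟨hu, ?_⟩
      rw [← h, Matrix.mul_assoc, Matrix.mul_assoc _ Pᵀ, ← Matrix.transpose_mul,
        Matrix.nonsing_inv_mul _ hu, Matrix.transpose_one, Matrix.mul_one,
        ← Matrix.mul_assoc, Matrix.nonsing_inv_mul _ hu, Matrix.one_mul]
    obtain ⟨hPu, hg⟩ := aux hηh hP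
    obtain ⟨hQu, hg'⟩ := aux hηv hQ
    refine ⟨P⁻¹, Q⁻¹, Matrix.isUnit_nonsing_inv_det _ hPu, Matrix.isUnit_nonsing_inv_det _ hQu,
      by rw [Matrix.nonsing_inv_nonsing_inv _ hPu, Matrix.nonsing_inv_nonsing_inv _ hQu], ?_,
      hg, hg'⟩
    simp [coframeMatrix, frameMatrix, Matrix.fromBlocks_multiply, Matrix.fromBlocks_one,
      ← Matrix.mul_assoc, Matrix.nonsing_inv_mul _ hPu, Matrix.nonsing_inv_mul _ hQu,
      Matrix.mul_assoc _ Q⁻¹]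

lemma IsPreferredFrame.blocks (hηh : ∀ i, ηh i = 1 ∨ ηh i = -1)
    (hηv : ∀ a, ηv a = 1 ∨ ηv a = -1) {gh : Matrix (Fin n) (Fin n) ℝ}
    {gv : Matrix (Fin m) (Fin m) ℝ} {N : Matrix (Fin m) (Fin n) ℝ}
    {E : Matrix (Idx n m) (Idx n m) ℝ} (hE : IsPreferredFrame ηh ηv gh gv N E) :
    E = frameMatrix N E.toBlocks₁₁ E.toBlocks₂₂ ∧
      E.toBlocks₁₁ * gh * E.toBlocks₁₁ᵀ = Matrix.diagonal ηh ∧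
      E.toBlocks₂₂ * gv * E.toBlocks₂₂ᵀ = Matrix.diagonal ηv := by
  obtain ⟨P, Q, h, hP, hQ⟩ := (isPreferredFrame_iff hηh hηv).1 hE
  have h1 : E.toBlocks₁₁ = P := by rw [h, frameMatrix, Matrix.toBlocks_fromBlocks₁₁]
  have h2 : E.toBlocks₂₂ = Q := by rw [h, frameMatrix, Matrix.toBlocks_fromBlocks₂₂]
  rw [h1, h2]
  exact ⟨h, hP, hQ⟩

lemma IsPreferredFrame.isUnit_det {gh : Matrix (Fin n) (Fin n) ℝ}
    {gv : Matrix (Fin m) (Fin m) ℝ} {N : Matrix (Fin m) (Fin n) ℝ}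
    {E : Matrix (Idx n m) (Idx n m) ℝ} (h : IsPreferredFrame ηh ηv gh gv N E) :
    IsUnit E.det := by
  obtain ⟨A, B, -, -, -, h, -, -⟩ := h
  exact Matrix.isUnit_det_of_left_inverse h

/-- The bracketed factor is `P⁻¹`, so this concerns `P' P⁻¹`: two orthonormal frames of one metric
differ by an `η`-orthogonal matrix. -/
lemma mul_mul_eq_diagonal {ι : Type} [Fintype ι] [DecidableEq ι] {η : ι → ℝ}
    (hη : ∀ i, η i = 1 ∨ η i = -1) {P P' g : Matrix ι ι ℝ}
    (h : P * g * Pᵀ = Matrix.diagonal η) (h' : P' * g * P'ᵀ = Matrix.diagonal η) :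
    P' * (g * Pᵀ * Matrix.diagonal η) * Matrix.diagonal η *
      (P' * (g * Pᵀ * Matrix.diagonal η))ᵀ = Matrix.diagonal η := by
  set W := g * Pᵀ * Matrix.diagonal η with hW
  have hPW : P * W = 1 := mul_eq_one_of_orthonormal hη h
  have hWP : W * P = 1 := mul_eq_one_comm.1 hPW
  have hg : W * Matrix.diagonal η * Wᵀ = g := by
    have : Pᵀ * Wᵀ = 1 := by rw [← Matrix.transpose_mul, hWP, Matrix.transpose_one]
    rw [← h, Matrix.mul_assoc, Matrix.mul_assoc _ Pᵀ, this, Matrix.mul_one, ← Matrix.mul_assoc,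
      hWP, Matrix.one_mul]
  rw [Matrix.transpose_mul, ← Matrix.mul_assoc, Matrix.mul_assoc P', Matrix.mul_assoc P', hg, h']

/-- With one index raised, `g⁻¹R` is an endomorphism, so a change of basis conjugates it. -/
lemma coordTensor_evolution_matrix {N : Matrix (Fin m) (Fin n) ℝ}
    {G R E : Matrix (Idx n m) (Idx n m) ℝ} (hG : IsUnit G.det) :
    E * ((coordTensor N G)⁻¹ * coordTensor N R)ᵀ
      = E * toAdapted N * (G⁻¹ * R)ᵀ * toAdapted (-N) := by
  set C := toAdapted N with hC
  set D := toAdapted (-N) with hD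
  have hCD : C * D = 1 := toAdapted_mul_toAdapted_neg N
  have hDC : D * C = 1 := mul_eq_one_comm.1 hCD
  have hCD' : Cᵀ * Dᵀ = 1 := by rw [← Matrix.transpose_mul, hDC, Matrix.transpose_one]
  have hinv : (coordTensor N G)⁻¹ = Dᵀ * G⁻¹ * D := by
    refine Matrix.inv_eq_right_inv ?_
    rw [coordTensor, ← hC]
    calc C * G * Cᵀ * (Dᵀ * G⁻¹ * D) = C * G * (Cᵀ * Dᵀ) * G⁻¹ * D := by
          simp only [Matrix.mul_assoc]
      _ = C * (G * G⁻¹) * D := by rw [hCD', Matrix.mul_one, Matrix.mul_assoc C]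
      _ = 1 := by rw [Matrix.mul_nonsing_inv _ hG, Matrix.mul_one, hCD]
  have h : (coordTensor N G)⁻¹ * coordTensor N R = Dᵀ * (G⁻¹ * R) * Cᵀ := by
    rw [hinv, coordTensor, ← hC]
    calc Dᵀ * G⁻¹ * D * (C * R * Cᵀ) = Dᵀ * G⁻¹ * (D * C) * R * Cᵀ := by
          simp only [Matrix.mul_assoc]
      _ = Dᵀ * (G⁻¹ * R) * Cᵀ := by rw [hDC, Matrix.mul_one, Matrix.mul_assoc Dᵀ]
  rw [h, Matrix.transpose_mul, Matrix.transpose_mul, Matrix.transpose_transpose,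
    Matrix.transpose_transpose]
  simp only [Matrix.mul_assoc]

end Algebra

/-! ### The evolution equation along the flow. -/

section Evolution

variable {n m : ℕ} {U : Set (Coord n m)} {τ₀ : ℝ}

/-- Frame vectors are rows, so the endomorphism `g⁻¹R` acts from the right by its transpose. -/
lemma frameEvolution_iff {g R e : FrameFamily n m} :
    FrameEvolution U τ₀ g R e ↔ ∀ τ ∈ Ico 0 τ₀, ∀ u ∈ U, ∀ α' α,
      HasDerivWithinAt (fun s => e s u α' α) ((e τ u * ((g τ u)⁻¹ * R τ u)ᵀ) α' α)
        (Ico 0 τ₀) τ := by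
  have key : ∀ τ u α α', ∑ β, ∑ γ, (g τ u)⁻¹ α β * R τ u β γ * e τ u α' γ
      = (e τ u * ((g τ u)⁻¹ * R τ u)ᵀ) α' α := by
    intro τ u α α'
    simp only [Matrix.mul_apply, Matrix.transpose_apply, Finset.mul_sum]
    rw [Finset.sum_comm]
    refine Finset.sum_congr rfl fun γ _ => Finset.sum_congr rfl fun β _ => ?_
    ring
  simp only [FrameEvolution, key]
  exact ⟨fun h τ hτ u hu α' α => h τ hτ u hu α α', fun h τ hτ u hu α α' => h τ hτ u hu α' α⟩

/-- Vielbeins of a metric evolving by `∂g = -2R` (with `R` symmetric) evolve by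
`∂P = P (g⁻¹ R)ᵀ` and stay orthonormal. -/
lemma exists_orthonormal_evolution {ι : Type} [Fintype ι] [DecidableEq ι] (hU : IsOpen U)
    (hτ₀ : 0 < τ₀) {g R : ℝ → Coord n m → Matrix ι ι ℝ} (hg : SmoothFamily U τ₀ g)
    (hR : SmoothFamily U τ₀ R) (hgs : ∀ τ ∈ Ico 0 τ₀, ∀ u ∈ U, (g τ u).IsSymm)
    (hRs : ∀ τ ∈ Ico 0 τ₀, ∀ u ∈ U, (R τ u).IsSymm)
    (hdet : ∀ τ ∈ Ico 0 τ₀, ∀ u ∈ U, (g τ u).det ≠ 0)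
    (hev : ∀ τ ∈ Ico 0 τ₀, ∀ u ∈ U, ∀ i j,
      HasDerivWithinAt (fun s => g s u i j) (-2 * R τ u i j) (Ico 0 τ₀) τ)
    {η : ι → ℝ} {P₀ : Coord n m → Matrix ι ι ℝ}
    (hP₀ : ∀ i j, ContDiffOn ℝ ∞ (fun u => P₀ u i j) U)
    (hP₀η : ∀ u ∈ U, P₀ u * g 0 u * (P₀ u)ᵀ = Matrix.diagonal η) :
    ∃ P : ℝ → Coord n m → Matrix ι ι ℝ, SmoothFamily U τ₀ P ∧ (∀ u ∈ U, P 0 u = P₀ u) ∧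
      (∀ τ ∈ Ico 0 τ₀, ∀ u ∈ U, ∀ i j, HasDerivWithinAt (fun s => P s u i j)
        ((P τ u * ((g τ u)⁻¹ * R τ u)ᵀ) i j) (Ico 0 τ₀) τ) ∧
      ∀ τ ∈ Ico 0 τ₀, ∀ u ∈ U, P τ u * g τ u * (P τ u)ᵀ = Matrix.diagonal η := by
  obtain ⟨P, hP, hP0, hPd⟩ :=
    exists_smoothFamily_linear_ODE hU hτ₀ ((hg.inv hdet).mul hR).transpose hP₀
  refine ⟨P, hP, hP0, hPd, fun τ hτ u hu => ?_⟩
  rw [← hP₀η u hu, ← hP0 u hu]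
  ext i j
  refine eq_initial_of_hasDerivWithinAt_zero
    (f := fun s => (P s u * g s u * (P s u)ᵀ) i j) (fun t ht => ?_) hτ
  have h1 := hasDerivWithinAt_matrix_mul (hPd t ht u hu) (Y' := (-2 : ℝ) • R t u)
    (fun i j => by simpa using hev t ht u hu i j)
  have h2 := hasDerivWithinAt_matrix_mul h1 (Y := fun s => (P s u)ᵀ)
    (Y' := (P t u * ((g t u)⁻¹ * R t u)ᵀ)ᵀ) (fun i j => hPd t ht u hu j i) i j
  convert h2 using 1
  have hgu := (hdet t ht u hu).isUnit
  -- Symmetry of `g` and `R` enters here, turning `(g⁻¹R)ᵀ g` into `R`; `e2` needs only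
  -- invertibility of `g`.
  have e1 : P t u * ((g t u)⁻¹ * R t u)ᵀ * g t u = P t u * R t u := by
    rw [Matrix.transpose_mul, Matrix.transpose_nonsing_inv, hgs t ht u hu, hRs t ht u hu,
      Matrix.mul_assoc, Matrix.mul_assoc, Matrix.nonsing_inv_mul _ hgu, Matrix.mul_one]
  have e2 : P t u * g t u * (P t u * ((g t u)⁻¹ * R t u)ᵀ)ᵀ = P t u * R t u * (P t u)ᵀ := by
    rw [Matrix.transpose_mul, Matrix.transpose_transpose, ← Matrix.mul_assoc,
      ← Matrix.mul_assoc, Matrix.mul_assoc (P t u) (g t u), Matrix.mul_nonsing_inv _ hgu,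
      Matrix.mul_one]
  rw [e1, e2, Matrix.mul_smul, ← Matrix.add_mul]
  have : P t u * R t u + (-2 : ℝ) • (P t u * R t u) + P t u * R t u = 0 := by module
  rw [this, Matrix.zero_mul, Matrix.zero_apply]

variable {gh : ℝ → Coord n m → Matrix (Fin n) (Fin n) ℝ}
  {gv : ℝ → Coord n m → Matrix (Fin m) (Fin m) ℝ} {N : ℝ → Coord n m → Matrix (Fin m) (Fin n) ℝ}

/-- The h-part `R̂_{ij}` of the canonical Ricci d-tensor. -/
noncomputable def ricciH (gh : ℝ → Coord n m → Matrix (Fin n) (Fin n) ℝ)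
    (gv : ℝ → Coord n m → Matrix (Fin m) (Fin m) ℝ)
    (N : ℝ → Coord n m → Matrix (Fin m) (Fin n) ℝ) (τ : ℝ) (u : Coord n m) :
    Matrix (Fin n) (Fin n) ℝ :=
  (ricci (gh τ) (gv τ) (N τ) u).toBlocks₁₁

/-- The v-part `R̂_{ab}` of the canonical Ricci d-tensor. -/
noncomputable def ricciV (gh : ℝ → Coord n m → Matrix (Fin n) (Fin n) ℝ)
    (gv : ℝ → Coord n m → Matrix (Fin m) (Fin m) ℝ)
    (N : ℝ → Coord n m → Matrix (Fin m) (Fin n) ℝ) (τ : ℝ) (u : Coord n m) :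
    Matrix (Fin m) (Fin m) ℝ :=
  (ricci (gh τ) (gv τ) (N τ) u).toBlocks₂₂

namespace IsRicciFlow

/-- `g_{ij}` and `g_{ji}` are the same function of time, and its derivative within `[0, τ₀)` is
unique. -/
lemma ricciH_isSymm (hflow : IsRicciFlow U τ₀ gh gv N) {τ : ℝ} (hτ : τ ∈ Ico 0 τ₀)
    {u : Coord n m} (hu : u ∈ U) : (ricciH gh gv N τ u).IsSymm := by
  ext i j
  have h1 := hflow.evol_h τ hτ u hu i j
  have h2 := (hflow.evol_h τ hτ u hu j i).congr (f₁ := fun s => gh s u i j)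
    (fun s hs => (hflow.symm_h s hs u hu).apply j i) ((hflow.symm_h τ hτ u hu).apply j i)
  have := hasDerivWithinAt_Ico_unique hτ h1 h2
  change ricci _ _ _ u (Sum.inl j) (Sum.inl i) = ricci _ _ _ u (Sum.inl i) (Sum.inl j)
  linarith

lemma ricciV_isSymm (hflow : IsRicciFlow U τ₀ gh gv N) {τ : ℝ} (hτ : τ ∈ Ico 0 τ₀)
    {u : Coord n m} (hu : u ∈ U) : (ricciV gh gv N τ u).IsSymm := by
  ext i j
  have h1 := hflow.evol_v τ hτ u hu i j
  have h2 := (hflow.evol_v τ hτ u hu j i).congr (f₁ := fun s => gv s u i j)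
    (fun s hs => (hflow.symm_v s hs u hu).apply j i) ((hflow.symm_v τ hτ u hu).apply j i)
  have := hasDerivWithinAt_Ico_unique hτ h1 h2
  change ricci _ _ _ u (Sum.inr j) (Sum.inr i) = ricci _ _ _ u (Sum.inr i) (Sum.inr j)
  linarith

lemma smooth_ricciH (hU : IsOpen U) (hflow : IsRicciFlow U τ₀ gh gv N) :
    SmoothFamily U τ₀ (ricciH gh gv N) :=
  SmoothFamily.of_hasDerivWithinAt hU (X := fun τ u => Matrix.of fun i j => -1 / 2 * gh τ u i j)
    (fun i j => contDiffOn_const.mul (hflow.smooth_h i j))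
    fun τ hτ u hu i j => by
      have h := (hflow.evol_h τ hτ u hu i j).const_mul (-1 / 2 : ℝ)
      have e : -1 / 2 * (-2 * ricci (gh τ) (gv τ) (N τ) u (Sum.inl i) (Sum.inl j))
          = ricciH gh gv N τ u i j := by
        change _ = ricci (gh τ) (gv τ) (N τ) u (Sum.inl i) (Sum.inl j)
        ring
      rwa [e] at h

lemma smooth_ricciV (hU : IsOpen U) (hflow : IsRicciFlow U τ₀ gh gv N) :
    SmoothFamily U τ₀ (ricciV gh gv N) :=
  SmoothFamily.of_hasDerivWithinAt hU (X := fun τ u => Matrix.of fun i j => -1 / 2 * gv τ u i j)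
    (fun i j => contDiffOn_const.mul (hflow.smooth_v i j))
    fun τ hτ u hu i j => by
      have h := (hflow.evol_v τ hτ u hu i j).const_mul (-1 / 2 : ℝ)
      have e : -1 / 2 * (-2 * ricci (gh τ) (gv τ) (N τ) u (Sum.inr i) (Sum.inr j))
          = ricciV gh gv N τ u i j := by
        change _ = ricci (gh τ) (gv τ) (N τ) u (Sum.inr i) (Sum.inr j)
        ring
      rwa [e] at h

lemma symHV_ricci (hflow : IsRicciFlow U τ₀ gh gv N) {τ : ℝ} (hτ : τ ∈ Ico 0 τ₀)
    {u : Coord n m} (hu : u ∈ U) : symHV (ricci (gh τ) (gv τ) (N τ) u)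
      = Matrix.fromBlocks (ricciH gh gv N τ u) 0 0 (ricciV gh gv N τ u) := by
  have h1 := hflow.ricciH_isSymm hτ hu
  have h2 := hflow.ricciV_isSymm hτ hu
  rw [Matrix.IsSymm, ricciH] at h1
  rw [Matrix.IsSymm, ricciV] at h2
  rw [symHV, h1, h2, ricciH, ricciV, ← two_smul ℝ, ← two_smul ℝ (Matrix.toBlocks₂₂ _),
    smul_smul, smul_smul]
  norm_num

lemma inv_mul_symHV_ricci (hflow : IsRicciFlow U τ₀ gh gv N) {τ : ℝ} (hτ : τ ∈ Ico 0 τ₀)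
    {u : Coord n m} (hu : u ∈ U) :
    (dMetric (gh τ u) (gv τ u))⁻¹ * symHV (ricci (gh τ) (gv τ) (N τ) u)
      = Matrix.fromBlocks ((gh τ u)⁻¹ * ricciH gh gv N τ u) 0 0
          ((gv τ u)⁻¹ * ricciV gh gv N τ u) := by
  rw [hflow.symHV_ricci hτ hu, dMetric_inv (hflow.nondeg_h τ hτ u hu) (hflow.nondeg_v τ hτ u hu),
    dMetric, Matrix.fromBlocks_multiply]
  simp

lemma smooth_inv_mul_symHV_ricci (hU : IsOpen U) (hflow : IsRicciFlow U τ₀ gh gv N) :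
    SmoothFamily U τ₀ fun τ u =>
      (dMetric (gh τ u) (gv τ u))⁻¹ * symHV (ricci (gh τ) (gv τ) (N τ) u) := by
  have h := ((hflow.smooth_h.inv hflow.nondeg_h).mul (hflow.smooth_ricciH hU)).fromBlocks
    (SmoothFamily.const 0) (SmoothFamily.const 0)
    ((hflow.smooth_v.inv hflow.nondeg_v).mul (hflow.smooth_ricciV hU))
  intro i j
  refine (h i j).congr ?_
  rintro ⟨τ, u⟩ ⟨hτ, hu⟩
  exact congrFun (congrFun (hflow.inv_mul_symHV_ricci hτ hu) i) j

/-- Neither family has to be smooth or preferred: adapted components solve one linear ODE with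
continuous coefficients, and the passage to them is invertible. -/
lemma evolves_unique (hU : IsOpen U) (hflow : IsRicciFlow U τ₀ gh gv N) {E E' : FrameFamily n m}
    (hE : Evolves U τ₀ gh gv N E) (hE' : Evolves U τ₀ gh gv N E')
    (h0 : ∀ u ∈ U, E' 0 u = E 0 u) {τ : ℝ} (hτ : τ ∈ Ico 0 τ₀) {u : Coord n m} (hu : u ∈ U) :
    E' τ u = E τ u := by
  rw [Evolves, frameEvolution_iff] at hE hE'
  have h := matrix_linear_ODE_unique
    (fun i j => (hflow.smooth_inv_mul_symHV_ricci hU).transpose.continuousOn_time hu i j)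
    (fun t ht => hE' t ht u hu) (fun t ht => hE t ht u hu)
    (by simp only [adaptedComponents]; rw [h0 u hu]) hτ
  have h' := congrArg (· * toAdapted (-N τ u)) h
  simpa only [adaptedComponents, Matrix.mul_assoc, toAdapted_mul_toAdapted_neg,
    Matrix.mul_one] using h'

end IsRicciFlow

end Evolution

end NAnholonomic

/-! ### Existence, rotations and the two equivalences. -/

namespace NAnholonomic

variable {n m : ℕ} {U : Set (Coord n m)} {τ₀ : ℝ}
  {gh : ℝ → Coord n m → Matrix (Fin n) (Fin n) ℝ}
  {gv : ℝ → Coord n m → Matrix (Fin m) (Fin m) ℝ} {N : ℝ → Coord n m → Matrix (Fin m) (Fin n) ℝ}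
  {ηh : Fin n → ℝ} {ηv : Fin m → ℝ}

namespace IsRicciFlow

/-- The h- and v-blocks are evolved separately and reassembled with the current `N`. Adapted
components cancel `N` again, so no equation for `∂N/∂τ` is needed. -/
theorem exists_preferred_evolution (hU : IsOpen U) (hτ₀ : 0 < τ₀)
    (hflow : IsRicciFlow U τ₀ gh gv N) (hηh : ∀ i, ηh i = 1 ∨ ηh i = -1)
    (hηv : ∀ a, ηv a = 1 ∨ ηv a = -1) {E₀ : Coord n m → Matrix (Idx n m) (Idx n m) ℝ}
    (hE₀ : ∀ α' α, ContDiffOn ℝ ∞ (fun u => E₀ u α' α) U)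
    (hE₀p : ∀ u ∈ U, IsPreferredFrame ηh ηv (gh 0 u) (gv 0 u) (N 0 u) (E₀ u)) :
    ∃ E : FrameFamily n m, SmoothFamily U τ₀ E ∧ (∀ u ∈ U, E 0 u = E₀ u) ∧
      Evolves U τ₀ gh gv N E ∧ PreferredFamily U τ₀ ηh ηv gh gv N E := by
  have hblocks := fun u hu => (hE₀p u hu).blocks hηh hηv
  obtain ⟨P, hP, hP0, hPd, hPη⟩ := exists_orthonormal_evolution hU hτ₀ hflow.smooth_h
    (hflow.smooth_ricciH hU) hflow.symm_h (fun _ hτ _ hu => hflow.ricciH_isSymm hτ hu)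
    hflow.nondeg_h hflow.evol_h (P₀ := fun u => (E₀ u).toBlocks₁₁)
    (fun i j => hE₀ (Sum.inl i) (Sum.inl j)) fun u hu => (hblocks u hu).2.1
  obtain ⟨Q, hQ, hQ0, hQd, hQη⟩ := exists_orthonormal_evolution hU hτ₀ hflow.smooth_v
    (hflow.smooth_ricciV hU) hflow.symm_v (fun _ hτ _ hu => hflow.ricciV_isSymm hτ hu)
    hflow.nondeg_v hflow.evol_v (P₀ := fun u => (E₀ u).toBlocks₂₂)
    (fun i j => hE₀ (Sum.inr i) (Sum.inr j)) fun u hu => (hblocks u hu).2.2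
  refine ⟨fun τ u => frameMatrix (N τ u) (P τ u) (Q τ u), ?_, fun u hu => ?_, ?_, ?_⟩
  · exact hP.fromBlocks (hP.mul hflow.smooth_N.transpose).neg (SmoothFamily.const 0) hQ
  · change frameMatrix (N 0 u) (P 0 u) (Q 0 u) = E₀ u
    rw [hP0 u hu, hQ0 u hu, ← (hblocks u hu).1]
  · rw [Evolves, frameEvolution_iff]
    intro τ hτ u hu
    simp only [adaptedComponents, frameMatrix_mul_toAdapted]
    rw [hflow.inv_mul_symHV_ricci hτ hu, Matrix.fromBlocks_transpose, Matrix.fromBlocks_multiply]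
    simp only [Matrix.transpose_zero, Matrix.mul_zero, Matrix.zero_mul, add_zero, zero_add]
    rintro (i | i) (j | j)
    · exact hPd τ hτ u hu i j
    · exact hasDerivWithinAt_const τ _ _
    · exact hasDerivWithinAt_const τ _ _
    · exact hQd τ hτ u hu i j
  · exact fun τ hτ u hu =>
      (isPreferredFrame_iff hηh hηv).2 ⟨_, _, rfl, hPη τ hτ u hu, hQη τ hτ u hu⟩

theorem exists_rotation (hU : IsOpen U) (hτ₀ : 0 < τ₀)
    (hflow : IsRicciFlow U τ₀ gh gv N) (hηh : ∀ i, ηh i = 1 ∨ ηh i = -1)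
    (hηv : ∀ a, ηv a = 1 ∨ ηv a = -1) {E : FrameFamily n m} (hE : SmoothFamily U τ₀ E)
    (hEp : PreferredFamily U τ₀ ηh ηv gh gv N E) :
    ∃ (Λh : ℝ → Coord n m → Matrix (Fin n) (Fin n) ℝ)
      (Λv : ℝ → Coord n m → Matrix (Fin m) (Fin m) ℝ),
      SmoothFamily U τ₀ Λh ∧ SmoothFamily U τ₀ Λv ∧
      (∀ u ∈ U, Λh 0 u = 1 ∧ Λv 0 u = 1) ∧
      (∀ τ ∈ Ico 0 τ₀, ∀ u ∈ U,
        Λh τ u * Matrix.diagonal ηh * (Λh τ u)ᵀ = Matrix.diagonal ηh ∧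
        Λv τ u * Matrix.diagonal ηv * (Λv τ u)ᵀ = Matrix.diagonal ηv) ∧
      Evolves U τ₀ gh gv N (fun τ u => Matrix.fromBlocks (Λh τ u) 0 0 (Λv τ u) * E τ u) := by
  have hz : (0 : ℝ) ∈ Ico 0 τ₀ := ⟨le_rfl, hτ₀⟩
  have hmaps : MapsTo (fun u : Coord n m => ((0 : ℝ), u)) U (Ico 0 τ₀ ×ˢ U) :=
    fun u hu => ⟨hz, hu⟩
  obtain ⟨F, hF, hF0, hFe, hFp⟩ := hflow.exists_preferred_evolution hU hτ₀ hηh hηv (E₀ := E 0)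
    (fun α' α => (hE α' α).comp (by fun_prop) hmaps) fun u hu => hEp 0 hz u hu
  have hEb := fun τ hτ u hu => (hEp τ hτ u hu).blocks hηh hηv
  have hFb := fun τ hτ u hu => (hFp τ hτ u hu).blocks hηh hηv
  have hh : ∀ {E : FrameFamily n m}, SmoothFamily U τ₀ E →
      SmoothFamily U τ₀ fun τ u => (E τ u).toBlocks₁₁ := fun hE i j => hE (Sum.inl i) (Sum.inl j)
  have hv : ∀ {E : FrameFamily n m}, SmoothFamily U τ₀ E →
      SmoothFamily U τ₀ fun τ u => (E τ u).toBlocks₂₂ := fun hE i j => hE (Sum.inr i) (Sum.inr j)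
  -- Blockwise `F E⁻¹`, with the inverse written as `g Pᵀ η` to make smoothness evident.
  refine ⟨fun τ u => (F τ u).toBlocks₁₁ * (gh τ u * (E τ u).toBlocks₁₁ᵀ * Matrix.diagonal ηh),
    fun τ u => (F τ u).toBlocks₂₂ * (gv τ u * (E τ u).toBlocks₂₂ᵀ * Matrix.diagonal ηv),
    (hh hF).mul ((hflow.smooth_h.mul (hh hE).transpose).mul (SmoothFamily.const _)),
    (hv hF).mul ((hflow.smooth_v.mul (hv hE).transpose).mul (SmoothFamily.const _)),
    fun u hu => ?_, fun τ hτ u hu => ?_, ?_⟩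
  · simp only [hF0 u hu]
    exact ⟨mul_eq_one_of_orthonormal hηh (hEb 0 hz u hu).2.1,
      mul_eq_one_of_orthonormal hηv (hEb 0 hz u hu).2.2⟩
  · exact ⟨mul_mul_eq_diagonal hηh (hEb τ hτ u hu).2.1 (hFb τ hτ u hu).2.1,
      mul_mul_eq_diagonal hηv (hEb τ hτ u hu).2.2 (hFb τ hτ u hu).2.2⟩
  · have heq : ∀ τ ∈ Ico 0 τ₀, ∀ u ∈ U, Matrix.fromBlocks
        ((F τ u).toBlocks₁₁ * (gh τ u * (E τ u).toBlocks₁₁ᵀ * Matrix.diagonal ηh)) 0 0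
        ((F τ u).toBlocks₂₂ * (gv τ u * (E τ u).toBlocks₂₂ᵀ * Matrix.diagonal ηv)) * E τ u
        = F τ u := by
      intro τ hτ u hu
      obtain ⟨hE1, hE2, hE3⟩ := hEb τ hτ u hu
      nth_rewrite 3 [hE1]
      rw [fromBlocks_mul_frameMatrix, Matrix.mul_assoc _ _ (E τ u).toBlocks₁₁,
        Matrix.mul_assoc _ _ (E τ u).toBlocks₂₂,
        mul_eq_one_comm.1 (mul_eq_one_of_orthonormal hηh hE2),
        mul_eq_one_comm.1 (mul_eq_one_of_orthonormal hηv hE3), Matrix.mul_one, Matrix.mul_one,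
        ← (hFb τ hτ u hu).1]
    rw [Evolves, frameEvolution_iff] at hFe ⊢
    intro τ hτ u hu α' α
    have h := hFe τ hτ u hu α' α
    simp only [adaptedComponents] at h ⊢
    rw [heq τ hτ u hu]
    exact h.congr (fun s hs => by rw [heq s hs u hu]) (by rw [heq τ hτ u hu])

/-- The rotated families coincide by uniqueness for the ODE, and the blocks of `E` cancel;
orthogonality of the rotations plays no role. -/
theorem rotation_unique (hU : IsOpen U) (hflow : IsRicciFlow U τ₀ gh gv N)
    (hηh : ∀ i, ηh i = 1 ∨ ηh i = -1) (hηv : ∀ a, ηv a = 1 ∨ ηv a = -1) {E : FrameFamily n m}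
    (hEp : PreferredFamily U τ₀ ηh ηv gh gv N E)
    {Λh Λh' : ℝ → Coord n m → Matrix (Fin n) (Fin n) ℝ}
    {Λv Λv' : ℝ → Coord n m → Matrix (Fin m) (Fin m) ℝ}
    (h0 : ∀ u ∈ U, Λh 0 u = 1 ∧ Λv 0 u = 1) (h0' : ∀ u ∈ U, Λh' 0 u = 1 ∧ Λv' 0 u = 1)
    (h : Evolves U τ₀ gh gv N (fun τ u => Matrix.fromBlocks (Λh τ u) 0 0 (Λv τ u) * E τ u))
    (h' : Evolves U τ₀ gh gv N (fun τ u => Matrix.fromBlocks (Λh' τ u) 0 0 (Λv' τ u) * E τ u))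
    {τ : ℝ} (hτ : τ ∈ Ico 0 τ₀) {u : Coord n m} (hu : u ∈ U) :
    Λh' τ u = Λh τ u ∧ Λv' τ u = Λv τ u := by
  have key := hflow.evolves_unique hU h h' (fun u hu => by
    simp only [(h0 u hu).1, (h0 u hu).2, (h0' u hu).1, (h0' u hu).2]) hτ hu
  obtain ⟨P, Q, hE, hP, hQ⟩ := (isPreferredFrame_iff hηh hηv).1 (hEp τ hτ u hu)
  simp only [hE, fromBlocks_mul_frameMatrix] at key
  obtain ⟨k1, k2⟩ := frameMatrix_inj key
  have aux : ∀ {k : ℕ} {P W X Y : Matrix (Fin k) (Fin k) ℝ}, P * W = 1 → X * P = Y * P →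
      X = Y := by
    intro k P W X Y hW hXY
    rw [← Matrix.mul_one X, ← Matrix.mul_one Y, ← hW, ← Matrix.mul_assoc, hXY, Matrix.mul_assoc]
  exact ⟨aux (mul_eq_one_of_orthonormal hηh hP) k1, aux (mul_eq_one_of_orthonormal hηv hQ) k2⟩

theorem evolvesFull_iff (hflow : IsRicciFlow U τ₀ gh gv N) {E : FrameFamily n m}
    (hEp : PreferredFamily U τ₀ ηh ηv gh gv N E) (hE : Evolves U τ₀ gh gv N E) :
    EvolvesFull U τ₀ gh gv N E ↔ ∀ τ ∈ Ico 0 τ₀, ∀ u ∈ U, ∀ (i : Fin n) (a : Fin m),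
      ricci (gh τ) (gv τ) (N τ) u (Sum.inl i) (Sum.inr a) = 0 ∧
      ricci (gh τ) (gv τ) (N τ) u (Sum.inr a) (Sum.inl i) = 0 := by
  have hmixed : ∀ τ ∈ Ico 0 τ₀, ∀ u ∈ U,
      (symHV (ricci (gh τ) (gv τ) (N τ) u) = ricci (gh τ) (gv τ) (N τ) u ↔
        ∀ (i : Fin n) (a : Fin m), ricci (gh τ) (gv τ) (N τ) u (Sum.inl i) (Sum.inr a) = 0 ∧
          ricci (gh τ) (gv τ) (N τ) u (Sum.inr a) (Sum.inl i) = 0) := by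
    intro τ hτ u hu
    rw [hflow.symHV_ricci hτ hu]
    constructor
    · intro h i a
      rw [← h]
      exact ⟨rfl, rfl⟩
    · intro h
      ext (i | i) (j | j)
      exacts [rfl, (h i j).1.symm, (h j i).2.symm, rfl]
  rw [Evolves, frameEvolution_iff] at hE
  rw [EvolvesFull, frameEvolution_iff]
  constructor
  · intro hF τ hτ u hu
    rw [← hmixed τ hτ u hu]
    have h : adaptedComponents N E τ u * ((dMetric (gh τ u) (gv τ u))⁻¹
          * symHV (ricci (gh τ) (gv τ) (N τ) u))ᵀ
        = adaptedComponents N E τ u * ((dMetric (gh τ u) (gv τ u))⁻¹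
          * ricci (gh τ) (gv τ) (N τ) u)ᵀ := by
      ext α' α
      exact hasDerivWithinAt_Ico_unique hτ (hE τ hτ u hu α' α) (hF τ hτ u hu α' α)
    have hu1 : IsUnit (adaptedComponents N E τ u) := by
      rw [Matrix.isUnit_iff_isUnit_det, adaptedComponents, Matrix.det_mul]
      exact (hEp τ hτ u hu).isUnit_det.mul
        (Matrix.isUnit_det_of_right_inverse (toAdapted_mul_toAdapted_neg _))
    have hu2 := Matrix.isUnit_nonsing_inv_det _
      (isUnit_det_dMetric (hflow.nondeg_h τ hτ u hu) (hflow.nondeg_v τ hτ u hu))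
    rw [← Matrix.isUnit_iff_isUnit_det] at hu2
    -- Equal derivatives give equal right sides; the frame and then `g⁻¹` cancel, leaving equality
    -- of the two Ricci matrices.
    exact hu2.mul_left_cancel (Matrix.transpose_injective (hu1.mul_left_cancel h))
  · intro h τ hτ u hu
    rw [← (hmixed τ hτ u hu).2 (h τ hτ u hu)]
    exact hE τ hτ u hu

theorem evolvesCoord_iff (hflow : IsRicciFlow U τ₀ gh gv N) {E : FrameFamily n m}
    (hEp : PreferredFamily U τ₀ ηh ηv gh gv N E) (hE : Evolves U τ₀ gh gv N E) :
    EvolvesCoord U τ₀ gh gv N E ↔ ∀ τ ∈ Ico 0 τ₀, ∀ u ∈ U, N τ u = N 0 u := by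
  rw [Evolves, frameEvolution_iff] at hE
  rw [EvolvesCoord, frameEvolution_iff]
  have hG : ∀ τ ∈ Ico 0 τ₀, ∀ u ∈ U, IsUnit (dMetric (gh τ u) (gv τ u)).det := fun τ hτ u hu =>
    isUnit_det_dMetric (hflow.nondeg_h τ hτ u hu) (hflow.nondeg_v τ hτ u hu)
  constructor
  · intro hC τ hτ u hu
    ext a i
    refine eq_initial_of_hasDerivWithinAt_zero (f := fun s => N s u a i) (fun t ht => ?_) hτ
    set N' : Matrix (Fin m) (Fin n) ℝ := Matrix.of fun a i =>
      derivWithin (fun s => N s u a i) (Ico 0 τ₀) t with hN'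
    have hNd : ∀ a i, HasDerivWithinAt (fun s => N s u a i) (N' a i) (Ico 0 τ₀) t := fun a i =>
      hflow.smooth_N.hasDerivWithinAt hu ht a i
    set C' : Matrix (Idx n m) (Idx n m) ℝ := Matrix.fromBlocks 0 N'ᵀ 0 0 with hC'
    have hCd : ∀ α β, HasDerivWithinAt (fun s => toAdapted (N s u) α β) (C' α β)
        (Ico 0 τ₀) t := by
      rintro (α | α) (β | β)
      · exact hasDerivWithinAt_const t _ _
      · exact hNd β α
      · exact hasDerivWithinAt_const t _ _
      · exact hasDerivWithinAt_const t _ _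
    have h := hC t ht u hu
    simp only [coordTensor_evolution_matrix (hG t ht u hu)] at h
    -- Product rule for `e = E C`: the coordinate equation gives `e' = e (g⁻¹R)ᵀ + E C'`, whereas
    -- the adapted equation lacks the last term. Hence `E C' = 0`, and `C' = 0` as `E` is
    -- invertible.
    have hprod := hasDerivWithinAt_matrix_mul h hCd
    have hzero : E t u * C' = 0 := by
      have heq : E t u * toAdapted (N t u) * ((dMetric (gh t u) (gv t u))⁻¹
          * symHV (ricci (gh t) (gv t) (N t) u))ᵀ * toAdapted (-N t u) * toAdapted (N t u)
          + E t u * C' = E t u * toAdapted (N t u) * ((dMetric (gh t u) (gv t u))⁻¹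
          * symHV (ricci (gh t) (gv t) (N t) u))ᵀ := by
        ext α' α
        exact hasDerivWithinAt_Ico_unique ht (hprod α' α) (hE t ht u hu α' α)
      rwa [Matrix.mul_assoc _ (toAdapted (-N t u)),
        mul_eq_one_comm.1 (toAdapted_mul_toAdapted_neg _), Matrix.mul_one, add_eq_left] at heq
    have hEu := (Matrix.isUnit_iff_isUnit_det _).2 (hEp t ht u hu).isUnit_det
    have hC0 : C' = 0 := hEu.mul_left_cancel (hzero.trans (Matrix.mul_zero _).symm)
    have hN0 : N' a i = 0 := congrFun (congrFun hC0 (Sum.inl i)) (Sum.inr a)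
    have h := hNd a i
    rwa [hN0] at h
  · intro hN τ hτ u hu α' α
    rw [coordTensor_evolution_matrix (hG τ hτ u hu)]
    -- Now the change of basis is constant in time, so `E = e C⁻¹` is differentiated by
    -- differentiating `e` alone.
    have hprod := hasDerivWithinAt_matrix_mul (hE τ hτ u hu) (Y := fun _ => toAdapted (-N 0 u))
      (Y' := 0) (fun _ _ => hasDerivWithinAt_const τ _ _) α' α
    rw [Matrix.mul_zero, add_zero, ← hN τ hτ u hu] at hprod
    refine hprod.congr_of_mem (fun s hs => ?_) hτ
    rw [adaptedComponents, hN τ hτ u hu, ← hN s hs u hu, Matrix.mul_assoc,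
      toAdapted_mul_toAdapted_neg, Matrix.mul_one]

end IsRicciFlow

end NAnholonomic

theorem mainTheorem12 (n m : ℕ) (U : Set (Coord n m)) (hU : IsOpen U) (τ₀ : ℝ) (hτ₀ : 0 < τ₀)
    (gh : ℝ → Coord n m → Matrix (Fin n) (Fin n) ℝ)
    (gv : ℝ → Coord n m → Matrix (Fin m) (Fin m) ℝ)
    (N : ℝ → Coord n m → Matrix (Fin m) (Fin n) ℝ)
    (hflow : IsRicciFlow U τ₀ gh gv N)
    (ηh : Fin n → ℝ) (ηv : Fin m → ℝ)
    (hηh : ∀ i, ηh i = 1 ∨ ηh i = -1) (hηv : ∀ a, ηv a = 1 ∨ ηv a = -1) :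
    -- every initial preferred frame evolves by the equation, for all times and in a unique way,
    -- and stays preferred
    (∀ E₀ : Coord n m → Matrix (Idx n m) (Idx n m) ℝ,
      (∀ α' α, ContDiffOn ℝ ∞ (fun u => E₀ u α' α) U) →
      (∀ u ∈ U, IsPreferredFrame ηh ηv (gh 0 u) (gv 0 u) (N 0 u) (E₀ u)) →
      ∃ E : FrameFamily n m,
        SmoothFamily U τ₀ E ∧ (∀ u ∈ U, E 0 u = E₀ u) ∧
        Evolves U τ₀ gh gv N E ∧ PreferredFamily U τ₀ ηh ηv gh gv N E ∧
        ∀ E' : FrameFamily n m, (∀ u ∈ U, E' 0 u = E₀ u) → Evolves U τ₀ gh gv N E' →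
          ∀ τ ∈ Set.Ico 0 τ₀, ∀ u ∈ U, E' τ u = E τ u) ∧
    -- every family of preferred frames evolves by the equation after a unique N-adapted
    -- pseudo-orthogonal rotation that is trivial at the initial time
    (∀ E : FrameFamily n m, SmoothFamily U τ₀ E → PreferredFamily U τ₀ ηh ηv gh gv N E →
      ∃ (Λh : ℝ → Coord n m → Matrix (Fin n) (Fin n) ℝ)
        (Λv : ℝ → Coord n m → Matrix (Fin m) (Fin m) ℝ),
        SmoothFamily U τ₀ Λh ∧ SmoothFamily U τ₀ Λv ∧
        (∀ u ∈ U, Λh 0 u = 1 ∧ Λv 0 u = 1) ∧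
        (∀ τ ∈ Set.Ico 0 τ₀, ∀ u ∈ U,
          Λh τ u * Matrix.diagonal ηh * (Λh τ u)ᵀ = Matrix.diagonal ηh ∧
          Λv τ u * Matrix.diagonal ηv * (Λv τ u)ᵀ = Matrix.diagonal ηv) ∧
        Evolves U τ₀ gh gv N (fun τ u => Matrix.fromBlocks (Λh τ u) 0 0 (Λv τ u) * E τ u) ∧
        ∀ (Λh' : ℝ → Coord n m → Matrix (Fin n) (Fin n) ℝ)
          (Λv' : ℝ → Coord n m → Matrix (Fin m) (Fin m) ℝ),
          (∀ u ∈ U, Λh' 0 u = 1 ∧ Λv' 0 u = 1) →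
          Evolves U τ₀ gh gv N (fun τ u => Matrix.fromBlocks (Λh' τ u) 0 0 (Λv' τ u) * E τ u) →
          ∀ τ ∈ Set.Ico 0 τ₀, ∀ u ∈ U, Λh' τ u = Λh τ u ∧ Λv' τ u = Λv τ u) ∧
    -- the h- and v-parts of the canonical Ricci d-tensor are symmetric along the flow
    (∀ τ ∈ Set.Ico 0 τ₀, ∀ u ∈ U,
      (∀ i j : Fin n, ricci (gh τ) (gv τ) (N τ) u (Sum.inl i) (Sum.inl j)
        = ricci (gh τ) (gv τ) (N τ) u (Sum.inl j) (Sum.inl i)) ∧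
      (∀ a b : Fin m, ricci (gh τ) (gv τ) (N τ) u (Sum.inr a) (Sum.inr b)
        = ricci (gh τ) (gv τ) (N τ) u (Sum.inr b) (Sum.inr a))) ∧
    -- preferred frames that evolve by the equation satisfy it with the whole Ricci d-tensor
    -- exactly when the mixed components of that tensor vanish
    (∀ E : FrameFamily n m, PreferredFamily U τ₀ ηh ηv gh gv N E → Evolves U τ₀ gh gv N E →
      (EvolvesFull U τ₀ gh gv N E ↔
        ∀ τ ∈ Set.Ico 0 τ₀, ∀ u ∈ U, ∀ (i : Fin n) (a : Fin m),
          ricci (gh τ) (gv τ) (N τ) u (Sum.inl i) (Sum.inr a) = 0 ∧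
          ricci (gh τ) (gv τ) (N τ) u (Sum.inr a) (Sum.inl i) = 0)) ∧
    -- and they satisfy it in coordinate components exactly when the N-connection is constant in `τ`
    (∀ E : FrameFamily n m, PreferredFamily U τ₀ ηh ηv gh gv N E → Evolves U τ₀ gh gv N E →
      (EvolvesCoord U τ₀ gh gv N E ↔ ∀ τ ∈ Set.Ico 0 τ₀, ∀ u ∈ U, N τ u = N 0 u)) := by
  refine ⟨fun E₀ hE₀ hE₀p => ?_, fun E hE hEp => ?_, fun τ hτ u hu => ⟨fun i j => ?_,
    fun a b => ?_⟩, fun E hEp hE => hflow.evolvesFull_iff hEp hE,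
    fun E hEp hE => hflow.evolvesCoord_iff hEp hE⟩
  · obtain ⟨E, hE, h0, hev, hp⟩ := hflow.exists_preferred_evolution hU hτ₀ hηh hηv hE₀ hE₀p
    exact ⟨E, hE, h0, hev, hp, fun E' h0' hev' τ hτ u hu =>
      hflow.evolves_unique hU hev hev' (fun u hu => (h0' u hu).trans (h0 u hu).symm) hτ hu⟩
  · obtain ⟨Λh, Λv, hh, hv, h0, hη, hev⟩ := hflow.exists_rotation hU hτ₀ hηh hηv hE hEp
    exact ⟨Λh, Λv, hh, hv, h0, hη, hev, fun Λh' Λv' h0' hev' τ hτ u hu =>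
      hflow.rotation_unique hU hηh hηv hEp h0 h0' hev hev' hτ hu⟩
  · exact (hflow.ricciH_isSymm hτ hu).apply j i
  · exact (hflow.ricciV_isSymm hτ hu).apply b a
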